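/- **Model.** A ring of $n\ge 3$ anonymous nodes evolves in synchronous rounds; in each round an adversary removes at most one edge (the choice may be different in each round and is arbitrary). Three agents start at arbitrary nodes (not necessarily distinct). Each agent has an identifier, a bit string of the same length $k>1$, and the three identifiers are pairwise distinct. The agents do not know $n$; all run the same deterministic algorithm, which does not depend on $n$, and initially an agent knows only its own identifier. In each round every active agent first exchanges messages with the other active agents at its node, then computes from its memory, the received messages and the information whether its last attempted move failed, and decides to stay, to move left, to move right (in its private orientation), or to terminate; an attempted move succeeds if and only if the edge is present in that round. Agents crossing the same edge in opposite directions do not notice each other, and terminated agents do nothing and cannot be detected. The agents have *chirality* if their private orientations (left/right) agree. *Exploration with explicit termination* is solved in $R$ rounds if within $R$ rounds every node has been visited by at least one agent and all three agents have terminated, and no agent terminates before every node has been visited. **Theorem.** Exploration with explicit termination is solvable by three agents with chirality in $$2^{k+\lceil\log_2 n\rceil+3}+23n = O(2^k n)$$ rounds. That is, there is one deterministic algorithm such that for all $k>1$ and $n\ge 3$, all pairwise distinct identifiers of length $k$, all initial positions, all common orientations and all sequences of missing edges, the algorithm solves Exploration with explicit termination in $2^{k+\lceil\log_2 n\rceil+3}+23n$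 rounds; and there is an absolute constant $C$ with $2^{k+\lceil\log_2 n\rceil+3}+23n\le C\,2^k n$ for all such $k,n$. -/

import Mathlib

/-!
# Three agents on a dynamic ring

The ring of size `n` has node set `ZMod n`.  Node `v` and node `v + 1` are joined by the edge
called `v`, and `v + 1` is the clockwise neighbour of `v`.
-/

namespace DynamicRing

/-- The two directions of the ring, as seen by an outside observer. -/
inductive Rotation where
  | clockwise
  | counterclockwise
  deriving DecidableEq

/-- What an agent may decide at the end of its Compute phase; `left` and `right` refer to the
agent's private orientation. -/
inductive Action where
  | stay
  | left
  | right
  | terminate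
  deriving DecidableEq

/-- A deterministic algorithm for identified agents.  All agents run the same algorithm.  It
depends neither on the size of the ring nor on the position, the orientation or the index of the
agent; the only initial knowledge of an agent is its identifier (and hence its length `k`).

* `init` is the initial memory, computed from the identifier;
* `msg` is the message that an agent shows to the active agents at its own node in the Look phase;
* `compute` takes the current memory, the information whether the agent attempted to move in the
  previous round and failed, and the messages received in the Look phase (one for every other
  active agent at the node), and returns the new memory and the decision. -/
structure Algorithm where
  Mem : Type
  Msg : Type
  init : (k : ℕ) → (Fin k → Bool) → Mem
  msg : Mem → Msg
  compute : Mem → Bool → Multiset Msg → Mem × Action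

/-- A global configuration of three agents in the ring of size `n`. -/
structure Config (A : Algorithm) (n : ℕ) where
  pos : Fin 3 → ZMod n
  mem : Fin 3 → A.Mem
  failed : Fin 3 → Bool
  terminated : Fin 3 → Bool

/-- The direction of the ring in which an agent attempts to move, if it attempts to move.
`o` is the direction that the agent calls right. -/
def heading (o : Rotation) : Action → Option Rotation
  | .stay => none
  | .terminate => none
  | .right => some o
  | .left =>
    match o with
    | .clockwise => some .counterclockwise
    | .counterclockwise => some .clockwise

/-- The edge used to leave node `v` in a given direction. -/
def edgeFrom {n : ℕ} (v : ZMod n) : Rotation → ZMod n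
  | .clockwise => v
  | .counterclockwise => v - 1

/-- The neighbour of node `v` in a given direction. -/
def neighbour {n : ℕ} (v : ZMod n) : Rotation → ZMod n
  | .clockwise => v + 1
  | .counterclockwise => v - 1

/-- An attempted move is blocked if it uses the missing edge. -/
def blocked {n : ℕ} (missing : Option (ZMod n)) (v : ZMod n) : Option Rotation → Bool
  | none => false
  | some d => decide (missing = some (edgeFrom v d))

/-- The node reached from `v` by an attempted move. -/
def destination {n : ℕ} (missing : Option (ZMod n)) (v : ZMod n) : Option Rotation → ZMod n
  | none => v
  | some d => if missing = some (edgeFrom v d) then v else neighbour v d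

namespace Algorithm

variable (A : Algorithm) {n : ℕ}

/-- The initial configuration. -/
def initial {k : ℕ} (ident : Fin 3 → Fin k → Bool) (start : Fin 3 → ZMod n) : Config A n where
  pos := start
  mem i := A.init k (ident i)
  failed _ := false
  terminated _ := false

/-- Look: the messages of the other active agents at the node of agent `i`.  Terminated agents
cannot be detected. -/
def received (c : Config A n) (i : Fin 3) : Multiset A.Msg :=
  (Finset.univ.filter fun j => j ≠ i ∧ c.terminated j = false ∧ c.pos j = c.pos i).val.map
    fun j => A.msg (c.mem j)

/-- Compute: the new memory and the decision of agent `i`. -/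
def decision (c : Config A n) (i : Fin 3) : A.Mem × Action :=
  A.compute (c.mem i) (c.failed i) (A.received c i)

/-- One synchronous round (Look, Compute, Move), in which the edge `missing` is absent (no edge
is absent if it is `none`).  A terminated agent does nothing any more. -/
def round (orient : Fin 3 → Rotation) (missing : Option (ZMod n)) (c : Config A n) :
    Config A n where
  pos i := if c.terminated i then c.pos i else
    destination missing (c.pos i) (heading (orient i) (A.decision c i).2)
  mem i := if c.terminated i then c.mem i else (A.decision c i).1
  failed i := if c.terminated i then c.failed i else
    blocked missing (c.pos i) (heading (orient i) (A.decision c i).2)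
  terminated i := c.terminated i || decide ((A.decision c i).2 = .terminate)

/-- The configuration after `t` rounds; `missing t` is the edge absent in round `t + 1`. -/
def run {k : ℕ} (ident : Fin 3 → Fin k → Bool) (orient : Fin 3 → Rotation)
    (start : Fin 3 → ZMod n) (missing : ℕ → Option (ZMod n)) : ℕ → Config A n
  | 0 => A.initial ident start
  | t + 1 => A.round orient (missing t) (run ident orient start missing t)

end Algorithm

/-- Every node has been visited by at least one agent within the first `t` rounds. -/
def ExploredBy {A : Algorithm} {n : ℕ} (e : ℕ → Config A n) (t : ℕ) : Prop :=
  ∀ v : ZMod n, ∃ s ≤ t, ∃ i, (e s).pos i = v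

/-- Exploration with explicit termination is achieved within `R` rounds: within `R` rounds every
node is visited and all three agents terminate, and no agent terminates before the exploration
is complete. -/
def ExplorationWithExplicitTermination {A : Algorithm} {n : ℕ} (e : ℕ → Config A n) (R : ℕ) :
    Prop :=
  ExploredBy e R ∧ (∀ i, (e R).terminated i = true) ∧
    ∀ t i, (e t).terminated i = true → ExploredBy e t

/-- The agents have chirality: they agree on what is right (and hence on what is left). -/
def Chirality (orient : Fin 3 → Rotation) : Prop :=
  ∀ i j, orient i = orient j

/-- The number of rounds as a function of the identifier length and the size of the ring;
`Nat.clog 2 n` is the logarithm of `n` to base 2, rounded up. -/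
def roundBound (k n : ℕ) : ℕ :=
  2 ^ (k + Nat.clog 2 n + 3) + 23 * n

end DynamicRing

namespace DynamicRing

/-! The algorithm works in phases; phase `j` tests the guess `N = 2 ^ j` for the ring size. Each
phase forces two agents to meet, sends two agents apart from the common node, and then lets all
three share what they saw. The agents keep equal clocks, so all of them follow the same part of a
phase.

Meeting and sharing rest on one pursuit lemma, `exists_contact`: if two agents go right and the
third stays, each mover meets somebody within `3 * (n - 1)` rounds, because one missing edge cannot
stop two agents at different nodes. Slots indexed by identifiers make some agent stay alone in its
slot, which yields the first meeting.

In the run, the two movers measure integer coordinates from their common origin. Two coordinates of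
the same landmark (the anchor, or the edge missing in one fixed round) are congruent mod `n`.
Distinct ones differing by at most `N` therefore prove `n ≤ N`, so no test succeeds while `N < n`
(`not_conclusive`). Conversely, if `n ≤ N`, the run covers the ring and produces such a pair
(`exists_evidence`): the movers are both blocked only when `n` divides (total moves) + 1, so the
adversary must either hold them at the two ends of one edge in round `N - 1`, or let them go on
until the anchor has been seen at two coordinates. Three chases then spread this evidence to
everybody (`chase_known_subset`).

Hence all agents terminate together at the end of phase `Nat.clog 2 n`, and the phase lengths form a
geometric sum. A common counterclockwise orientation is reduced to the clockwise one by the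
reflection `chart`. -/

instance {α : Type*} {p : α → Prop} [DecidablePred p] (s : Multiset α) : Decidable (∃ x ∈ s, p x) :=
  Multiset.decidableExistsMultiset

/-! ### The algorithm -/

/-- The role of an agent after the first meeting of a phase. -/
inductive Role where
  | rightward
  | leftward
  | anchor
  deriving DecidableEq

/-- The memory of an agent.  In phase `phase` the algorithm works with the guess `2 ^ phase` for the
size of the ring; `clock` counts the rounds of the phase.  The set `known` holds landmarks with
their coordinates: `(true, a)` is the position of the anchor, `(false, a)` is the edge
missing in one fixed round. -/
structure Memory where
  len : ℕ
  ident : ℕ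
  phase : ℕ
  clock : ℕ
  stopped : Bool
  role : Role
  coord : ℤ
  known : Finset (Bool × ℤ)

/-- The memory at the beginning of a phase. -/
def Memory.fresh (k x j : ℕ) : Memory where
  len := k
  ident := x
  phase := j
  clock := 0
  stopped := false
  role := .anchor
  coord := 0
  known := ∅

/-- The number of rounds of a phase that are devoted to the first meeting. -/
def wanderTime (k j : ℕ) : ℕ := 3 * 2 ^ j * (2 ^ k - 1)

/-- The number of rounds of a phase. -/
def phaseLength (k j : ℕ) : ℕ := wanderTime k j + 11 * 2 ^ j

/-- Among the agents of a node, the one with the smallest identifier will go right, the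
one with the largest identifier will go left, and the others will stay. -/
def assignedRole (x : ℕ) (rcv : Multiset Memory) : Role :=
  if (∃ m ∈ rcv, m.ident < x) then
    if (∃ m ∈ rcv, x < m.ident) then .anchor else .leftward
  else
    if (∃ m ∈ rcv, x < m.ident) then .rightward else .anchor

/-- The action of an agent during the run that follows the first meeting. -/
def Role.action : Role → Action
  | .rightward => .right
  | .leftward => .left
  | .anchor => .stay

/-- The displacement of a successful move during the run. -/
def Role.shift : Role → ℤ
  | .rightward => 1
  | .leftward => -1
  | .anchor => 0

/-- The coordinate of the edge that an agent with coordinate `c` tries to use during the run. -/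
def Role.edgeCoord (c : ℤ) : Role → ℤ
  | .leftward => c - 1
  | _ => c

/-- The role that does not move in the `q`-th chase. -/
def chaseAnchor : ℕ → Role
  | 0 => .anchor
  | 1 => .leftward
  | _ => .rightward

/-- The same landmark has been seen at two coordinates that differ by at most `N`. -/
def Conclusive (N : ℕ) (s : Finset (Bool × ℤ)) : Prop :=
  ∃ a ∈ s, ∃ b ∈ s, a.1 = b.1 ∧ a.2 < b.2 ∧ b.2 ≤ a.2 + N

instance (N : ℕ) (s : Finset (Bool × ℤ)) : Decidable (Conclusive N s) := by
  unfold Conclusive; infer_instance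

/-- Until the first meeting: in the `x`-th slot the agent with identifier `x` stays and the others
go right; agents that meet stop. -/
def wander (m : Memory) (rcv : Multiset Memory) : Memory × Action :=
  ({ m with clock := m.clock + 1, stopped := m.stopped || decide (0 < rcv.card) },
    if (m.stopped || decide (0 < rcv.card)) = true ∨ m.clock / (3 * 2 ^ m.phase) = m.ident
      then .stay else .right)

/-- The distribution of the roles. -/
def assign (m : Memory) (rcv : Multiset Memory) : Memory × Action :=
  ({ m with clock := m.clock + 1, role := assignedRole m.ident rcv }, .stay)

/-- The coordinate of an agent in round `s` of the run. -/
def newCoord (m : Memory) (s : ℕ) (failed : Bool) : ℤ :=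
  if s = 0 then 0 else if failed then m.coord else m.coord + m.role.shift

/-- The landmarks observed in round `s` of the run. -/
def observed (m : Memory) (s : ℕ) (failed : Bool) (rcv : Multiset Memory) : Finset (Bool × ℤ) :=
  (if m.role ≠ .anchor ∧ ∃ m' ∈ rcv, m'.role = .anchor then {(true, newCoord m s failed)} else ∅) ∪
    (if m.role ≠ .anchor ∧ s = 2 ^ m.phase ∧ failed = true then
      {(false, m.role.edgeCoord (newCoord m s failed))} else ∅)

/-- Round `s` of the run. -/
def explore (m : Memory) (s : ℕ) (failed : Bool) (rcv : Multiset Memory) : Memory × Action :=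
  ({ m with
      clock := m.clock + 1
      coord := newCoord m s failed
      known := m.known ∪ observed m s failed rcv }, m.role.action)

/-- The landmarks that an agent knows after the exchange of messages. -/
def merged (m : Memory) (rcv : Multiset Memory) : Finset (Bool × ℤ) :=
  m.known ∪ (rcv.map Memory.known).sup

/-- Round `s` of the chases, in which the agents share what they know. -/
def chase (m : Memory) (s : ℕ) (rcv : Multiset Memory) : Memory × Action :=
  ({ m with clock := m.clock + 1, known := merged m rcv },
    if m.role = chaseAnchor (s / (3 * 2 ^ m.phase)) then .stay else .right)

/-- The last round of a phase. -/
def conclude (m : Memory) (rcv : Multiset Memory) : Memory × Action :=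
  (Memory.fresh m.len m.ident (m.phase + 1),
    if Conclusive (2 ^ m.phase) (merged m rcv) then .terminate else .stay)

/-- The Compute phase of the exploration algorithm. -/
def exploreCompute (m : Memory) (failed : Bool) (rcv : Multiset Memory) : Memory × Action :=
  if m.clock + 1 < wanderTime m.len m.phase then wander m rcv
  else if m.clock < wanderTime m.len m.phase then assign m rcv
  else if m.clock < wanderTime m.len m.phase + 2 * 2 ^ m.phase then
    explore m (m.clock - wanderTime m.len m.phase) failed rcv
  else if m.clock + 1 < phaseLength m.len m.phase then
    chase m (m.clock - (wanderTime m.len m.phase + 2 * 2 ^ m.phase)) rcv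
  else conclude m rcv

/-- The exploration algorithm. -/
def explorer : Algorithm where
  Mem := Memory
  Msg := Memory
  init k b := Memory.fresh k (Nat.ofBits b) 0
  msg m := m
  compute := exploreCompute

/-! ### Pursuit of a fixed agent on the ring -/

section Chase

variable {n : ℕ}

/-- The effect of an action when right is clockwise. -/
def moveTo (miss : Option (ZMod n)) (v : ZMod n) : Action → ZMod n
  | .right => if miss = some v then v else v + 1
  | .left => if miss = some (v - 1) then v else v - 1
  | _ => v

/-- Whether an action fails when right is clockwise. -/
def isHit (miss : Option (ZMod n)) (v : ZMod n) : Action → Bool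
  | .right => decide (miss = some v)
  | .left => decide (miss = some (v - 1))
  | _ => false

theorem zmod_val_sub_one [NeZero n] {a : ZMod n} (h : a ≠ 0) : (a - 1).val + 1 = a.val := by
  have hn : 1 < n := by
    rcases Nat.lt_or_ge 1 n with h1 | h1
    · exact h1
    · have : n = 1 := le_antisymm h1 (NeZero.pos n)
      subst this
      exact absurd (Subsingleton.elim a 0) h
  have : Fact (1 < n) := ⟨hn⟩
  have h0 : 0 < a.val := by
    rw [Nat.pos_iff_ne_zero]
    simpa [ZMod.val_eq_zero] using h
  rw [ZMod.val_sub (by rw [ZMod.val_one]; omega), ZMod.val_one]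
  omega

theorem zmod_val_add_one_le [NeZero n] (a : ZMod n) : (a + 1).val ≤ a.val + 1 := by
  refine (ZMod.val_add_le a 1).trans ?_
  have : (1 : ZMod n).val ≤ 1 := by
    rw [ZMod.val_one_eq_one_mod]; exact Nat.mod_le 1 n
  omega

/-- If `a` and `b` go right while `c` stays, then `b` meets `a` or `c`. -/
theorem exists_contact [NeZero n] (miss : ℕ → Option (ZMod n)) (a b c : ℕ → ZMod n)
    (ha : ∀ s < 3 * (n - 1), a (s + 1) = moveTo (miss s) (a s) .right)
    (hb : ∀ s < 3 * (n - 1), b (s + 1) = moveTo (miss s) (b s) .right)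
    (hc : ∀ s < 3 * (n - 1), c (s + 1) = c s) :
    ∃ s ≤ 3 * (n - 1), b s = a s ∨ b s = c s := by
  by_contra! hcon
  -- The potential `2 * dist(b, c) + dist(a, b)`, with distances measured to the right, starts at
  -- most at `3 * (n - 1)` and drops by at least 1 per round without contact.
  have key : ∀ s ≤ 3 * (n - 1),
      2 * (c s - b s).val + (b s - a s).val + s ≤ 3 * (n - 1) := by
    intro s
    induction s with
    | zero =>
      intro _
      have h1 := ZMod.val_lt (c 0 - b 0)
      have h2 := ZMod.val_lt (b 0 - a 0)
      omega
    | succ s ih =>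
      intro hs
      have ih := ih (by omega)
      obtain ⟨hba, hbc⟩ := hcon s (by omega)
      have h1 := zmod_val_sub_one (sub_ne_zero.mpr hbc.symm)
      have h2 := zmod_val_sub_one (sub_ne_zero.mpr hba)
      have h3 := zmod_val_add_one_le (b s - a s)
      rw [ha s (by omega), hb s (by omega), hc s (by omega)]
      simp only [moveTo]
      -- If `b` is blocked, `a` is at another node and advances. If `b` advances, the first term
      -- drops by 2 and the second grows by at most 1.
      by_cases hmb : miss s = some (b s)
      · have hma : miss s ≠ some (a s) := by
          rw [hmb]; simpa using hba
        rw [if_pos hmb, if_neg hma, show b s - (a s + 1) = b s - a s - 1 by ring]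
        omega
      · rw [if_neg hmb, show c s - (b s + 1) = c s - b s - 1 by ring]
        split_ifs
        · rw [show b s + 1 - a s = b s - a s + 1 by ring]
          omega
        · rw [show b s + 1 - (a s + 1) = b s - a s by ring]
          omega
  have h0 := key (3 * (n - 1)) le_rfl
  obtain ⟨-, hbc⟩ := hcon (3 * (n - 1)) le_rfl
  have h1 := zmod_val_sub_one (sub_ne_zero.mpr hbc.symm)
  omega

end Chase

/-! ### Two agents running apart, as integer sequences -/

section Run

/-- A discrete intermediate value argument: an agent that passes a coordinate has stood on it. -/
theorem exists_eq_of_le {x : ℕ → ℕ} (h0 : x 0 = 0) {s : ℕ}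
    (hx : ∀ i < s, x (i + 1) ≤ x i + 1) {c : ℕ} (hc : c ≤ x s) : ∃ i ≤ s, x i = c := by
  induction s with
  | zero => exact ⟨0, le_rfl, by omega⟩
  | succ s ih =>
    rcases Nat.lt_or_ge (x s) c with h | h
    · exact ⟨s + 1, le_rfl, by have := hx s (by omega); omega⟩
    · obtain ⟨i, hi, h⟩ := ih (fun i hi => hx i (by omega)) h
      exact ⟨i, by omega, h⟩

variable {n T : ℕ} {x y : ℕ → ℕ} {bx by' : ℕ → Bool}

/-- Two agents that leave a node in opposite directions have together made `n - 1` moves after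
`n - 1` rounds. -/
theorem le_total_moves
    (hx : ∀ s < T, x (s + 1) = x s + if bx s then 0 else 1)
    (hy : ∀ s < T, y (s + 1) = y s + if by' s then 0 else 1)
    (hb : ∀ s < T, bx s → by' s → n ∣ x s + y s + 1) :
    ∀ s ≤ T, n ≤ x s + y s + 1 ∨ s ≤ x s + y s := by
  intro s
  induction s with
  | zero => intro _; right; omega
  | succ s ih =>
    intro hs
    have ih := ih (by omega)
    have h1 := hx s (by omega)
    have h2 := hy s (by omega)
    rcases ih with ih | ih
    · left; omega
    · by_cases hh : bx s = true ∧ by' s = true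
      · have := Nat.le_of_dvd (by omega) (hb s (by omega) hh.1 hh.2)
        left; omega
      · right
        rw [h1, h2]
        cases h3 : bx s <;> cases h4 : by' s <;> simp_all <;> omega

/-- Two agents leave a node in opposite directions.  Within `2 * N` rounds, either they are blocked
at both ends of the same edge in round `N - 1`, or they have seen the node at distance `w` from two
sides. -/
theorem exists_evidence {N w : ℕ} (hN : n ≤ N) (hw : w < n)
    (hx0 : x 0 = 0) (hy0 : y 0 = 0)
    (hx : ∀ s < 2 * N, x (s + 1) = x s + if bx s then 0 else 1)
    (hy : ∀ s < 2 * N, y (s + 1) = y s + if by' s then 0 else 1)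
    (hb : ∀ s < 2 * N, bx s → by' s → n ∣ x s + y s + 1)
    (hsame : ∀ s < 2 * N, n ∣ x s + y s + 1 → (bx s ↔ by' s)) :
    (bx (N - 1) ∧ by' (N - 1) ∧ x (N - 1) + y (N - 1) + 1 = n) ∨
    (∃ s < 2 * N, ∃ s' < 2 * N, x s = w ∧ y s' = n - w) ∨
    (∃ s < 2 * N, ∃ s' < 2 * N, x s = w ∧ x s' = w + n) ∨
    (∃ s < 2 * N, ∃ s' < 2 * N, y s = n - w ∧ y s' = n - w + n) := by
  by_contra! hcon
  obtain ⟨c1, c2, c3, c4⟩ := hcon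
  have visx : ∀ s < 2 * N, ∀ c ≤ x s, ∃ i < 2 * N, x i = c := by
    intro s hs c hc
    obtain ⟨i, hi, h⟩ := exists_eq_of_le hx0 (fun i hi => by
      rw [hx i (by omega)]; split_ifs <;> omega) hc
    exact ⟨i, by omega, h⟩
  have visy : ∀ s < 2 * N, ∀ c ≤ y s, ∃ i < 2 * N, y i = c := by
    intro s hs c hc
    obtain ⟨i, hi, h⟩ := exists_eq_of_le hy0 (fun i hi => by
      rw [hy i (by omega)]; split_ifs <;> omega) hc
    exact ⟨i, by omega, h⟩
  -- Without evidence neither mover passes the anchor a second time, and they do not both reach it;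
  -- either way the total is at most `2 * n - 2`.
  have bound : ∀ s < 2 * N, n ≤ x s + y s → x s + y s + 2 ≤ 2 * n := by
    intro s hs hf
    have d1 : ¬ (w ≤ x s ∧ n - w ≤ y s) := fun ⟨h1, h2⟩ => by
      obtain ⟨i, hi, e1⟩ := visx s hs w h1
      obtain ⟨i', hi', e2⟩ := visy s hs _ h2
      exact c2 i hi i' hi' e1 e2
    have d2 : ¬ (w + n ≤ x s) := fun h1 => by
      obtain ⟨i, hi, e1⟩ := visx s hs w (by omega)
      obtain ⟨i', hi', e2⟩ := visx s hs _ h1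
      exact c3 i hi i' hi' e1 e2
    have d3 : ¬ (n - w + n ≤ y s) := fun h1 => by
      obtain ⟨i, hi, e1⟩ := visy s hs (n - w) (by omega)
      obtain ⟨i', hi', e2⟩ := visy s hs _ h1
      exact c4 i hi i' hi' e1 e2
    omega
  -- If the total is exactly `n - 1` in round `N - 1`, the movers face the same edge from its two
  -- ends. Since they are not both blocked there, by `hsame` neither is, and the total jumps past
  -- `n`.
  have hstart : n ≤ x N + y N := by
    have h1 := le_total_moves hx hy hb (N - 1) (by omega)
    have h2 := hx (N - 1) (by omega)
    have h3 := hy (N - 1) (by omega)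
    rw [show N - 1 + 1 = N by omega] at h2 h3
    by_cases h4 : x (N - 1) + y (N - 1) + 1 = n
    · have h5 := hsame (N - 1) (by omega) (by rw [h4])
      cases h6 : bx (N - 1) <;> cases h7 : by' (N - 1) <;> simp_all
      omega
    · omega
  -- For totals from `n` to `2 * n - 2`, the total plus 1 lies strictly between `n` and `2 * n`, so
  -- the movers cannot both be blocked. After `n - 1` more rounds the total contradicts `bound`.
  have grow : ∀ i ≤ n - 1, n + i ≤ x (N + i) + y (N + i) := by
    intro i
    induction i with
    | zero => intro _; simpa using hstart
    | succ i ih =>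
      intro hi
      have ih := ih (by omega)
      have hbd := bound (N + i) (by omega) (by omega)
      have h2 := hx (N + i) (by omega)
      have h3 := hy (N + i) (by omega)
      have h4 := hb (N + i) (by omega)
      by_cases hh : bx (N + i) = true ∧ by' (N + i) = true
      · exfalso
        obtain ⟨q, hq⟩ := h4 hh.1 hh.2
        have : q ≤ 1 := by
          by_contra hq1
          have := Nat.mul_le_mul_left n (show 2 ≤ q by omega)
          omega
        have := Nat.mul_le_mul_left n this
        omega
      · rw [← add_assoc N i 1, h2, h3]
        cases h6 : bx (N + i) <;> cases h7 : by' (N + i) <;> simp_all <;> omega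
  have h1 := grow (n - 1) le_rfl
  have h2 := bound (N + (n - 1)) (by omega) (by omega)
  omega

end Run

/-! ### Messages, and one phase as a sequence of states -/

/-- The memories of the other agents at the node of agent `i`. -/
def colocated {n : ℕ} (p : Fin 3 → ZMod n) (M : Fin 3 → Memory) (i : Fin 3) : Multiset Memory :=
  (Finset.univ.filter fun j => j ≠ i ∧ p j = p i).val.map M

theorem mem_colocated {n : ℕ} {p : Fin 3 → ZMod n} {M : Fin 3 → Memory} {i : Fin 3} {m : Memory} :
    m ∈ colocated p M i ↔ ∃ j, j ≠ i ∧ p j = p i ∧ M j = m := by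
  simp [colocated, and_assoc]

theorem card_colocated_pos {n : ℕ} {p : Fin 3 → ZMod n} {M : Fin 3 → Memory} {i : Fin 3} :
    0 < (colocated p M i).card ↔ ∃ j, j ≠ i ∧ p j = p i := by
  rw [Multiset.card_pos_iff_exists_mem]
  simp [mem_colocated]

theorem mem_sup_known {s : Multiset Memory} {e : Bool × ℤ} :
    e ∈ (s.map Memory.known).sup ↔ ∃ m ∈ s, e ∈ m.known := by
  induction s using Multiset.induction_on with
  | empty => simp
  | cons m s ih => simp [ih]

theorem mem_merged {m : Memory} {s : Multiset Memory} {e : Bool × ℤ} :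
    e ∈ merged m s ↔ e ∈ m.known ∨ ∃ m' ∈ s, e ∈ m'.known := by
  rw [merged, Finset.mem_union, mem_sup_known]

theorem Conclusive.mono {N : ℕ} {s t : Finset (Bool × ℤ)} (h : Conclusive N s) (hst : s ⊆ t) :
    Conclusive N t := by
  obtain ⟨a, ha, b, hb, h⟩ := h
  exact ⟨a, hst ha, b, hst hb, h⟩

theorem exploreCompute_header {m : Memory} {b : Bool} {r : Multiset Memory}
    (h : m.clock + 1 < phaseLength m.len m.phase) :
    (exploreCompute m b r).1.len = m.len ∧ (exploreCompute m b r).1.ident = m.ident ∧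
      (exploreCompute m b r).1.phase = m.phase ∧
      (exploreCompute m b r).1.clock = m.clock + 1 := by
  unfold exploreCompute
  split_ifs <;> simp [wander, assign, explore, chase]

/-- The course of one phase in which nobody is terminated, in coordinates in which right is
clockwise. -/
structure PhaseRun (n k j : ℕ) (ident : Fin 3 → ℕ) (p : ℕ → Fin 3 → ZMod n)
    (miss : ℕ → Option (ZMod n)) (M : ℕ → Fin 3 → Memory) (f : ℕ → Fin 3 → Bool) : Prop where
  start : ∀ i, M 0 i = Memory.fresh k (ident i) j
  mem_succ : ∀ t < phaseLength k j, ∀ i,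
    M (t + 1) i = (exploreCompute (M t i) (f t i) (colocated (p t) (M t) i)).1
  pos_succ : ∀ t < phaseLength k j, ∀ i, p (t + 1) i =
    moveTo (miss t) (p t i) (exploreCompute (M t i) (f t i) (colocated (p t) (M t) i)).2
  failed_succ : ∀ t < phaseLength k j, ∀ i, f (t + 1) i =
    isHit (miss t) (p t i) (exploreCompute (M t i) (f t i) (colocated (p t) (M t) i)).2

namespace PhaseRun

variable {n k j : ℕ} {ident : Fin 3 → ℕ} {p : ℕ → Fin 3 → ZMod n}
  {miss : ℕ → Option (ZMod n)} {M : ℕ → Fin 3 → Memory} {f : ℕ → Fin 3 → Bool}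

/-- Clocks and phases stay synchronised, so all agents execute the same branch of `exploreCompute`
in each round. -/
theorem header (H : PhaseRun n k j ident p miss M f) {t : ℕ} (ht : t < phaseLength k j)
    (i : Fin 3) : (M t i).len = k ∧ (M t i).ident = ident i ∧ (M t i).phase = j ∧
      (M t i).clock = t := by
  induction t with
  | zero => rw [H.start]; simp [Memory.fresh]
  | succ t ih =>
    obtain ⟨h1, h2, h3, h4⟩ := ih (by omega)
    rw [H.mem_succ t (by omega)]
    obtain ⟨g1, g2, g3, g4⟩ := exploreCompute_header (m := M t i) (b := f t i)
      (r := colocated (p t) (M t) i) (by rw [h1, h3, h4]; exact ht)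
    exact ⟨g1.trans h1, g2.trans h2, g3.trans h3, by rw [g4, h4]⟩

theorem compute_eq (H : PhaseRun n k j ident p miss M f) {t : ℕ} (ht : t < phaseLength k j)
    (i : Fin 3) : exploreCompute (M t i) (f t i) (colocated (p t) (M t) i) =
      if t + 1 < wanderTime k j then wander (M t i) (colocated (p t) (M t) i)
      else if t < wanderTime k j then assign (M t i) (colocated (p t) (M t) i)
      else if t < wanderTime k j + 2 * 2 ^ j then
        explore (M t i) (t - wanderTime k j) (f t i) (colocated (p t) (M t) i)
      else if t + 1 < phaseLength k j then
        chase (M t i) (t - (wanderTime k j + 2 * 2 ^ j)) (colocated (p t) (M t) i)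
      else conclude (M t i) (colocated (p t) (M t) i) := by
  obtain ⟨h1, h2, h3, h4⟩ := H.header ht i
  rw [exploreCompute, h1, h3, h4]

theorem wanderTime_le (k j : ℕ) : wanderTime k j + 11 * 2 ^ j ≤ phaseLength k j := le_rfl

/-! ### The first meeting -/

theorem wander_eq (H : PhaseRun n k j ident p miss M f) {t : ℕ} (ht : t + 1 < wanderTime k j)
    (i : Fin 3) : exploreCompute (M t i) (f t i) (colocated (p t) (M t) i) =
      wander (M t i) (colocated (p t) (M t) i) := by
  have := wanderTime_le k j
  rw [H.compute_eq (by omega), if_pos ht]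

theorem stopped_succ (H : PhaseRun n k j ident p miss M f) {t : ℕ} (ht : t + 1 < wanderTime k j)
    (i : Fin 3) : (M (t + 1) i).stopped = true ↔
      (M t i).stopped = true ∨ ∃ l, l ≠ i ∧ p t l = p t i := by
  have := wanderTime_le k j
  rw [H.mem_succ t (by omega), H.wander_eq ht]
  simp [wander, card_colocated_pos]

theorem wander_pos_succ (H : PhaseRun n k j ident p miss M f) {t : ℕ}
    (ht : t + 1 < wanderTime k j) (i : Fin 3) : p (t + 1) i = moveTo (miss t) (p t i)
      (if (M (t + 1) i).stopped = true ∨ t / (3 * 2 ^ j) = ident i then .stay else .right) := by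
  have := wanderTime_le k j
  obtain ⟨h1, h2, h3, h4⟩ := H.header (t := t) (by omega) i
  rw [H.pos_succ t (by omega), H.mem_succ t (by omega), H.wander_eq ht, wander]
  simp only [h2, h3, h4]

/-- Meeting is symmetric: both agents stop in the same round and never move again during the
wandering, so a stopped agent always has company. -/
theorem exists_partner (H : PhaseRun n k j ident p miss M f) {t : ℕ} (ht : t < wanderTime k j)
    (i : Fin 3) (hi : (M t i).stopped = true) :
    ∃ l, l ≠ i ∧ p t l = p t i ∧ (M t l).stopped = true := by
  induction t generalizing i with
  | zero => rw [H.start] at hi; simp [Memory.fresh] at hi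
  | succ t ih =>
    have stay : ∀ l, (M (t + 1) l).stopped = true → p (t + 1) l = p t l := by
      intro l hl
      rw [H.wander_pos_succ ht, if_pos (Or.inl hl)]
      rfl
    rcases (H.stopped_succ ht i).mp hi with h | ⟨l, hl, hp⟩
    · obtain ⟨l, hl, hp, hs⟩ := ih (by omega) i h
      have hs' := (H.stopped_succ ht l).mpr (Or.inl hs)
      exact ⟨l, hl, by rw [stay l hs', stay i hi, hp], hs'⟩
    · have hs' := (H.stopped_succ ht l).mpr (Or.inr ⟨i, hl.symm, hp.symm⟩)
      exact ⟨l, hl, by rw [stay l hs', stay i hi, hp], hs'⟩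

theorem stopped_mono (H : PhaseRun n k j ident p miss M f) {t t' : ℕ} (htt : t ≤ t')
    (ht : t' < wanderTime k j) (i : Fin 3) (hi : (M t i).stopped = true) :
    (M t' i).stopped = true := by
  induction t', htt using Nat.le_induction with
  | base => exact hi
  | succ t' _ ih => exact (H.stopped_succ ht i).mpr (Or.inl (ih (by omega)))

theorem exists_other_two (i : Fin 3) : ∃ a b : Fin 3, a ≠ b ∧ a ≠ i ∧ b ≠ i := by
  revert i; decide

/-- If the guess is large enough then two agents meet. -/
theorem exists_meeting (H : PhaseRun n k j ident p miss M f) (hn : 0 < n) (hnj : n ≤ 2 ^ j)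
    (hinj : Function.Injective ident) (hlt : ∀ i, ident i < 2 ^ k) :
    ∃ i l, i ≠ l ∧ p (wanderTime k j - 1) i = p (wanderTime k j - 1) l := by
  have : NeZero n := ⟨hn.ne'⟩
  -- There are only `2 ^ k - 1` slots, so the identifier `2 ^ k - 1` has none; but at most one agent
  -- bears it.
  obtain ⟨c, hc⟩ : ∃ c, ident c + 1 < 2 ^ k := by
    by_contra! h
    have h0 := h 0
    have h1 := h 1
    have h2 := hlt 0
    have h3 := hlt 1
    have := hinj (show ident 0 = ident 1 by omega)
    simp at this
  obtain ⟨a, b, hab, hac, hbc⟩ := exists_other_two c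
  have hw : 3 * 2 ^ j * (ident c + 1) ≤ wanderTime k j :=
    Nat.mul_le_mul_left _ (by omega)
  rw [Nat.mul_add, mul_one] at hw
  by_cases hst : ∃ i, (M (wanderTime k j - 1) i).stopped = true
  · obtain ⟨i, hi⟩ := hst
    obtain ⟨l, hl, hp, -⟩ := H.exists_partner (by omega) i hi
    exact ⟨l, i, hl, hp⟩
  -- If nobody ever stops, the slot of `c` is an undisturbed pursuit, and the contact it forces
  -- would stop somebody after all.
  · have hst : ∀ t < wanderTime k j, ∀ i, ¬ (M t i).stopped = true := fun t ht i hi =>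
      hst ⟨i, H.stopped_mono (by omega) (by omega) i hi⟩
    set S := 3 * 2 ^ j * ident c with hS
    have slot : ∀ s < 3 * (n - 1), (S + s) / (3 * 2 ^ j) = ident c := by
      intro s hs
      rw [hS, Nat.mul_add_div (by positivity), Nat.div_eq_of_lt (by omega), add_zero]
    have step : ∀ i, ∀ s < 3 * (n - 1), p (S + (s + 1)) i =
        moveTo (miss (S + s)) (p (S + s) i) (if i = c then .stay else .right) := by
      intro i s hs
      rw [← add_assoc, H.wander_pos_succ (by omega), slot s hs]
      simp [hst (S + s + 1) (by omega) i, hinj.eq_iff, eq_comm]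
    obtain ⟨s, hs, h⟩ := exists_contact (fun s => miss (S + s)) (fun s => p (S + s) a)
      (fun s => p (S + s) b) (fun s => p (S + s) c)
      (fun s hs => by have := step a s hs; rwa [if_neg hac] at this)
      (fun s hs => by have := step b s hs; rwa [if_neg hbc] at this)
      (fun s hs => by have := step c s hs; rwa [if_pos rfl] at this)
    exfalso
    have hlast : S + s + 1 < wanderTime k j := by omega
    rcases h with h | h
    · exact hst _ hlast b ((H.stopped_succ hlast b).mpr (Or.inr ⟨a, hab, h.symm⟩))
    · exact hst _ hlast b ((H.stopped_succ hlast b).mpr (Or.inr ⟨c, hbc.symm, h.symm⟩))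

/-! ### The roles -/

theorem wander_known (H : PhaseRun n k j ident p miss M f) {t : ℕ} (ht : t ≤ wanderTime k j)
    (i : Fin 3) : (M t i).known = ∅ := by
  have := wanderTime_le k j
  induction t with
  | zero => rw [H.start]; rfl
  | succ t ih =>
    rw [H.mem_succ t (by omega), H.compute_eq (by omega)]
    split_ifs <;> first | exact ih (by omega) | omega

theorem assign_pos (H : PhaseRun n k j ident p miss M f) (hw : 0 < wanderTime k j) (i : Fin 3) :
    p (wanderTime k j) i = p (wanderTime k j - 1) i := by
  have := wanderTime_le k j
  obtain ⟨t, ht⟩ : ∃ t, wanderTime k j = t + 1 := ⟨wanderTime k j - 1, by omega⟩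
  rw [show wanderTime k j - 1 = t by omega, ht, H.pos_succ t (by omega), H.compute_eq (by omega),
    if_neg (by omega), if_pos (by omega)]
  rfl

theorem assign_role (H : PhaseRun n k j ident p miss M f) (hw : 0 < wanderTime k j) (i : Fin 3) :
    (M (wanderTime k j) i).role = assignedRole (ident i) (colocated (p (wanderTime k j - 1))
      (M (wanderTime k j - 1)) i) := by
  have := wanderTime_le k j
  obtain ⟨t, ht⟩ : ∃ t, wanderTime k j = t + 1 := ⟨wanderTime k j - 1, by omega⟩
  rw [show wanderTime k j - 1 = t by omega, ht, H.mem_succ t (by omega), H.compute_eq (by omega),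
    if_neg (by omega), if_pos (by omega), assign]
  simp only [(H.header (t := t) (by omega) i).2.1]

theorem assign_role_eq (H : PhaseRun n k j ident p miss M f) (hw : 0 < wanderTime k j)
    (i : Fin 3) : (M (wanderTime k j) i).role =
      if (∃ l, p (wanderTime k j) l = p (wanderTime k j) i ∧ ident l < ident i) then
        if (∃ l, p (wanderTime k j) l = p (wanderTime k j) i ∧ ident i < ident l) then .anchor
        else .leftward
      else
        if (∃ l, p (wanderTime k j) l = p (wanderTime k j) i ∧ ident i < ident l) then .rightward
        else .anchor := by
  have := wanderTime_le k j
  have hid : ∀ l, (M (wanderTime k j - 1) l).ident = ident l := fun l =>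
    (H.header (by omega) l).2.1
  have e1 : (∃ m ∈ colocated (p (wanderTime k j - 1)) (M (wanderTime k j - 1)) i,
      m.ident < ident i) ↔ ∃ l, p (wanderTime k j) l = p (wanderTime k j) i ∧
        ident l < ident i := by
    simp only [mem_colocated, H.assign_pos hw]
    constructor
    · rintro ⟨m, ⟨l, -, hp, rfl⟩, h⟩
      exact ⟨l, hp, by rwa [hid] at h⟩
    · rintro ⟨l, hp, h⟩
      exact ⟨_, ⟨l, by rintro rfl; omega, hp, rfl⟩, by rwa [hid]⟩
  have e2 : (∃ m ∈ colocated (p (wanderTime k j - 1)) (M (wanderTime k j - 1)) i,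
      ident i < m.ident) ↔ ∃ l, p (wanderTime k j) l = p (wanderTime k j) i ∧
        ident i < ident l := by
    simp only [mem_colocated, H.assign_pos hw]
    constructor
    · rintro ⟨m, ⟨l, -, hp, rfl⟩, h⟩
      exact ⟨l, hp, by rwa [hid] at h⟩
    · rintro ⟨l, hp, h⟩
      exact ⟨_, ⟨l, by rintro rfl; omega, hp, rfl⟩, by rwa [hid]⟩
  rw [H.assign_role hw, assignedRole]
  simp only [e1, e2]

theorem fin_three_cover {a b c : Fin 3} (hab : a ≠ b) (hac : a ≠ c) (hbc : b ≠ c) (i : Fin 3) :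
    i = a ∨ i = b ∨ i = c := by
  omega

/-- If two agents meet in the first part of a phase then all three roles are distributed. -/
theorem exists_roles (H : PhaseRun n k j ident p miss M f) (hw : 0 < wanderTime k j)
    (hinj : Function.Injective ident) {i l : Fin 3} (hil : i ≠ l)
    (hp : p (wanderTime k j) i = p (wanderTime k j) l) :
    ∃ u v w, (M (wanderTime k j) u).role = .rightward ∧ (M (wanderTime k j) v).role = .leftward ∧
      (M (wanderTime k j) w).role = .anchor ∧ p (wanderTime k j) u = p (wanderTime k j) v := by
  wlog hlt : ident i < ident l generalizing i l
  · exact this hil.symm hp.symm (lt_of_le_of_ne (not_lt.mp hlt) (hinj.ne hil.symm))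
  obtain ⟨c, hci, hcl⟩ : ∃ c, c ≠ i ∧ c ≠ l := by
    clear hp hlt
    revert i l; decide
  have cover := fin_three_cover hil hci.symm hcl.symm
  have right : ∀ x y, p (wanderTime k j) y = p (wanderTime k j) x → ident x < ident y →
      (∀ z, p (wanderTime k j) z = p (wanderTime k j) x → ident x ≤ ident z) →
      (M (wanderTime k j) x).role = .rightward := fun x y h1 h2 h3 => by
    rw [H.assign_role_eq hw, if_neg (fun ⟨z, hz, h⟩ => absurd (h3 z hz) (by omega)),
      if_pos ⟨y, h1, h2⟩]
  have left : ∀ x y, p (wanderTime k j) y = p (wanderTime k j) x → ident y < ident x →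
      (∀ z, p (wanderTime k j) z = p (wanderTime k j) x → ident z ≤ ident x) →
      (M (wanderTime k j) x).role = .leftward := fun x y h1 h2 h3 => by
    rw [H.assign_role_eq hw, if_pos ⟨y, h1, h2⟩,
      if_neg (fun ⟨z, hz, h⟩ => absurd (h3 z hz) (by omega))]
  have mid : ∀ x y z, p (wanderTime k j) y = p (wanderTime k j) x → ident y < ident x →
      p (wanderTime k j) z = p (wanderTime k j) x → ident x < ident z →
      (M (wanderTime k j) x).role = .anchor := fun x y z h1 h2 h3 h4 => by
    rw [H.assign_role_eq hw, if_pos ⟨y, h1, h2⟩, if_pos ⟨z, h3, h4⟩]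
  by_cases hpc : p (wanderTime k j) c = p (wanderTime k j) l
  · have hpi := hpc.trans hp.symm
    rcases lt_or_gt_of_ne (hinj.ne hci) with h1 | h1
    · refine ⟨c, l, i, right c i hpi.symm h1 fun z _ => ?_, left l i hp hlt fun z _ => ?_,
        mid i c l hpi h1 hp.symm hlt, hpc⟩
      all_goals rcases cover z with rfl | rfl | rfl <;> omega
    · rcases lt_or_gt_of_ne (hinj.ne hcl) with h2 | h2
      · refine ⟨i, l, c, right i l hp.symm hlt fun z _ => ?_, left l i hp hlt fun z _ => ?_,
          mid c i l hpi.symm h1 hpc.symm h2, hp⟩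
        all_goals rcases cover z with rfl | rfl | rfl <;> omega
      · refine ⟨i, c, l, right i l hp.symm hlt fun z _ => ?_, left c i hpi.symm h1 fun z _ => ?_,
          mid l i c hp hlt hpc h2, hpi.symm⟩
        all_goals rcases cover z with rfl | rfl | rfl <;> omega
  · refine ⟨i, l, c, right i l hp.symm hlt fun z hz => ?_, left l i hp hlt fun z hz => ?_, ?_, hp⟩
    · rcases cover z with rfl | rfl | rfl
      · omega
      · omega
      · exact absurd (hz.trans hp) hpc
    · rcases cover z with rfl | rfl | rfl
      · omega
      · omega
      · exact absurd hz hpc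
    · have : ∀ z, p (wanderTime k j) z = p (wanderTime k j) c → z = c := fun z hz => by
        rcases cover z with rfl | rfl | rfl
        · exact absurd (hz.symm.trans hp) hpc
        · exact absurd hz.symm hpc
        · rfl
      rw [H.assign_role_eq hw, if_neg, if_neg]
      · rintro ⟨z, hz, h⟩
        rw [this z hz] at h
        omega
      · rintro ⟨z, hz, h⟩
        rw [this z hz] at h
        omega

/-- A mover's role implies a meeting, even when the guess is too small; soundness needs this to know
that both movers share an origin. -/
theorem exists_roles_of_ne (H : PhaseRun n k j ident p miss M f) (hw : 0 < wanderTime k j)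
    (hinj : Function.Injective ident) {i : Fin 3} (hi : (M (wanderTime k j) i).role ≠ .anchor) :
    ∃ u v w, (M (wanderTime k j) u).role = .rightward ∧ (M (wanderTime k j) v).role = .leftward ∧
      (M (wanderTime k j) w).role = .anchor ∧ p (wanderTime k j) u = p (wanderTime k j) v := by
  obtain ⟨l, hl, hp⟩ : ∃ l, l ≠ i ∧ p (wanderTime k j) l = p (wanderTime k j) i := by
    rw [H.assign_role_eq hw] at hi
    by_contra! h
    apply hi
    rw [if_neg, if_neg]
    · rintro ⟨l, hp, hl⟩
      exact h l (by rintro rfl; omega) hp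
    · rintro ⟨l, hp, hl⟩
      exact h l (by rintro rfl; omega) hp
  exact H.exists_roles hw hinj hl hp

end PhaseRun

namespace PhaseRun

variable {n k j : ℕ} {ident : Fin 3 → ℕ} {p : ℕ → Fin 3 → ZMod n}
  {miss : ℕ → Option (ZMod n)} {M : ℕ → Fin 3 → Memory} {f : ℕ → Fin 3 → Bool}

theorem role_eq (H : PhaseRun n k j ident p miss M f) {t : ℕ} (hat : wanderTime k j ≤ t)
    (ht : t < phaseLength k j) (i : Fin 3) : (M t i).role = (M (wanderTime k j) i).role := by
  induction t, hat using Nat.le_induction with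
  | base => rfl
  | succ t hat ih =>
    rw [← ih (by omega), H.mem_succ t (by omega), H.compute_eq (by omega), if_neg (by omega),
      if_neg (by omega)]
    split_ifs <;> rfl

/-! ### The run -/

theorem moveTo_action (m : Option (ZMod n)) (v : ZMod n) (r : Role) :
    moveTo m v r.action = if isHit m v r.action then v else v + (r.shift : ZMod n) := by
  cases r <;> simp [moveTo, isHit, Role.action, Role.shift, sub_eq_add_neg]

theorem run_eq (H : PhaseRun n k j ident p miss M f) {s : ℕ} (hs : s < 2 * 2 ^ j) (i : Fin 3) :
    exploreCompute (M (wanderTime k j + s) i) (f (wanderTime k j + s) i)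
      (colocated (p (wanderTime k j + s)) (M (wanderTime k j + s)) i) =
    explore (M (wanderTime k j + s) i) s (f (wanderTime k j + s) i)
      (colocated (p (wanderTime k j + s)) (M (wanderTime k j + s)) i) := by
  have := wanderTime_le k j
  rw [H.compute_eq (by omega), if_neg (by omega), if_neg (by omega), if_pos (by omega),
    Nat.add_sub_cancel_left]

theorem run_failed (H : PhaseRun n k j ident p miss M f) {s : ℕ} (hs : s < 2 * 2 ^ j)
    (i : Fin 3) : f (wanderTime k j + s + 1) i = isHit (miss (wanderTime k j + s))
      (p (wanderTime k j + s) i) (M (wanderTime k j) i).role.action := by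
  have := wanderTime_le k j
  rw [H.failed_succ _ (by omega), H.run_eq hs, explore, H.role_eq (by omega) (by omega)]

theorem run_pos (H : PhaseRun n k j ident p miss M f) {s : ℕ} (hs : s < 2 * 2 ^ j)
    (i : Fin 3) : p (wanderTime k j + s + 1) i = if f (wanderTime k j + s + 1) i
      then p (wanderTime k j + s) i
      else p (wanderTime k j + s) i + ((M (wanderTime k j) i).role.shift : ZMod n) := by
  have := wanderTime_le k j
  rw [H.run_failed hs, ← moveTo_action, H.pos_succ _ (by omega), H.run_eq hs, explore,
    H.role_eq (by omega) (by omega)]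

theorem run_coord_zero (H : PhaseRun n k j ident p miss M f) (i : Fin 3) :
    (M (wanderTime k j + 1) i).coord = 0 := by
  have := wanderTime_le k j
  have h := H.run_eq (s := 0) (by positivity) i
  rw [add_zero] at h
  have : 0 < 2 ^ j := by positivity
  rw [H.mem_succ _ (by omega), h]
  simp [explore, newCoord]

theorem run_coord (H : PhaseRun n k j ident p miss M f) {s : ℕ} (hs : s < 2 * 2 ^ j)
    (i : Fin 3) : (M (wanderTime k j + s + 1) i).coord =
      newCoord (M (wanderTime k j + s) i) s (f (wanderTime k j + s) i) := by
  have := wanderTime_le k j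
  rw [H.mem_succ _ (by omega), H.run_eq hs, explore]

theorem run_coord_succ (H : PhaseRun n k j ident p miss M f) {s : ℕ} (hs : s + 1 < 2 * 2 ^ j)
    (i : Fin 3) : (M (wanderTime k j + (s + 1) + 1) i).coord =
      if f (wanderTime k j + s + 1) i then (M (wanderTime k j + s + 1) i).coord
      else (M (wanderTime k j + s + 1) i).coord + (M (wanderTime k j) i).role.shift := by
  have := wanderTime_le k j
  rw [H.run_coord hs, newCoord, if_neg (by omega), H.role_eq (by omega) (by omega)]
  rfl

/-- The outcome of a move is revealed only one round later, so the coordinate for the position at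
the start of round `s` is stored at its end; hence the index `s + 1`. -/
theorem pos_eq_add_coord (H : PhaseRun n k j ident p miss M f) {s : ℕ} (hs : s < 2 * 2 ^ j)
    (i : Fin 3) : p (wanderTime k j + s) i =
      p (wanderTime k j) i + ((M (wanderTime k j + s + 1) i).coord : ZMod n) := by
  induction s with
  | zero => simp [H.run_coord_zero]
  | succ s ih =>
    have ih := ih (by omega)
    rw [H.run_coord_succ hs, ← add_assoc, H.run_pos (by omega), ih]
    split_ifs
    · rfl
    · push_cast; ring

theorem run_known (H : PhaseRun n k j ident p miss M f) {s : ℕ} (hs : s < 2 * 2 ^ j)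
    (i : Fin 3) : (M (wanderTime k j + s + 1) i).known = (M (wanderTime k j + s) i).known ∪
      observed (M (wanderTime k j + s) i) s (f (wanderTime k j + s) i)
        (colocated (p (wanderTime k j + s)) (M (wanderTime k j + s)) i) := by
  have := wanderTime_le k j
  rw [H.mem_succ _ (by omega), H.run_eq hs, explore]

theorem anchor_pos (H : PhaseRun n k j ident p miss M f) {s : ℕ} (hs : s < 2 * 2 ^ j)
    {i : Fin 3} (hi : (M (wanderTime k j) i).role = .anchor) :
    p (wanderTime k j + s) i = p (wanderTime k j) i := by
  induction s with
  | zero => rfl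
  | succ s ih =>
    rw [← add_assoc, H.run_pos (by omega), ih (by omega), hi]
    simp [Role.shift]

theorem mem_ite_singleton {α : Type*} {P : Prop} [Decidable P] {a b : α} :
    a ∈ (if P then {b} else ∅ : Finset α) ↔ P ∧ a = b := by
  split_ifs with h <;> simp [h]

theorem mem_observed (H : PhaseRun n k j ident p miss M f) {s : ℕ} (hs : s < 2 * 2 ^ j)
    {i : Fin 3} {e : Bool × ℤ} :
    e ∈ observed (M (wanderTime k j + s) i) s (f (wanderTime k j + s) i)
        (colocated (p (wanderTime k j + s)) (M (wanderTime k j + s)) i) ↔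
      (M (wanderTime k j) i).role ≠ .anchor ∧
      (((∃ l, (M (wanderTime k j) l).role = .anchor ∧
          p (wanderTime k j + s) l = p (wanderTime k j + s) i) ∧
        e = (true, (M (wanderTime k j + s + 1) i).coord)) ∨
      ((s = 2 ^ j ∧ f (wanderTime k j + s) i = true) ∧
        e = (false, (M (wanderTime k j) i).role.edgeCoord
          (M (wanderTime k j + s + 1) i).coord))) := by
  have := wanderTime_le k j
  have hr : ∀ l, (M (wanderTime k j + s) l).role = (M (wanderTime k j) l).role := fun l =>
    H.role_eq (by omega) (by omega) l
  rw [observed, ← H.run_coord hs, (H.header (by omega) i).2.2.1, hr]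
  by_cases h0 : (M (wanderTime k j) i).role = .anchor
  · simp [h0]
  have he : (∃ m' ∈ colocated (p (wanderTime k j + s)) (M (wanderTime k j + s)) i,
      m'.role = .anchor) ↔ ∃ l, (M (wanderTime k j) l).role = .anchor ∧
          p (wanderTime k j + s) l = p (wanderTime k j + s) i := by
    simp only [mem_colocated]
    constructor
    · rintro ⟨m, ⟨l, -, hp, rfl⟩, h⟩
      exact ⟨l, by rwa [hr] at h, hp⟩
    · rintro ⟨l, h, hp⟩
      exact ⟨_, ⟨l, by rintro rfl; exact h0 h, hp, rfl⟩, by rwa [hr]⟩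
  simp only [ne_eq, h0, not_false_eq_true, true_and, he, Finset.mem_union, mem_ite_singleton]

/-! ### The chases -/

theorem chase_eq (H : PhaseRun n k j ident p miss M f) {s : ℕ} (hs : s + 1 < 9 * 2 ^ j)
    (i : Fin 3) :
    exploreCompute (M (wanderTime k j + 2 * 2 ^ j + s) i) (f (wanderTime k j + 2 * 2 ^ j + s) i)
      (colocated (p (wanderTime k j + 2 * 2 ^ j + s)) (M (wanderTime k j + 2 * 2 ^ j + s)) i) =
    chase (M (wanderTime k j + 2 * 2 ^ j + s) i) s
      (colocated (p (wanderTime k j + 2 * 2 ^ j + s)) (M (wanderTime k j + 2 * 2 ^ j + s)) i) := by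
  have := wanderTime_le k j
  rw [H.compute_eq (by omega), if_neg (by omega), if_neg (by omega), if_neg (by omega),
    if_pos (by omega), Nat.add_sub_cancel_left]

theorem chase_known (H : PhaseRun n k j ident p miss M f) {s : ℕ} (hs : s + 1 < 9 * 2 ^ j)
    (i : Fin 3) : (M (wanderTime k j + 2 * 2 ^ j + s + 1) i).known =
      merged (M (wanderTime k j + 2 * 2 ^ j + s) i) (colocated (p (wanderTime k j + 2 * 2 ^ j + s))
        (M (wanderTime k j + 2 * 2 ^ j + s)) i) := by
  have := wanderTime_le k j
  rw [H.mem_succ _ (by omega), H.chase_eq hs, chase]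

theorem chase_pos (H : PhaseRun n k j ident p miss M f) {s : ℕ} (hs : s + 1 < 9 * 2 ^ j)
    (i : Fin 3) : p (wanderTime k j + 2 * 2 ^ j + s + 1) i =
      moveTo (miss (wanderTime k j + 2 * 2 ^ j + s)) (p (wanderTime k j + 2 * 2 ^ j + s) i)
        (if (M (wanderTime k j) i).role = chaseAnchor (s / (3 * 2 ^ j)) then .stay
          else .right) := by
  have := wanderTime_le k j
  rw [H.pos_succ _ (by omega), H.chase_eq hs, chase, (H.header (by omega) i).2.2.1,
    H.role_eq (by omega) (by omega)]

theorem known_mono (H : PhaseRun n k j ident p miss M f) {t t' : ℕ} (ht : wanderTime k j ≤ t)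
    (htt : t ≤ t') (ht' : t' < phaseLength k j) (i : Fin 3) :
    (M t i).known ⊆ (M t' i).known := by
  have hl : phaseLength k j = wanderTime k j + 11 * 2 ^ j := rfl
  induction t', htt using Nat.le_induction with
  | base => exact subset_rfl
  | succ t' htt ih =>
    refine (ih (by omega)).trans ?_
    rcases Nat.lt_or_ge t' (wanderTime k j + 2 * 2 ^ j) with h | h
    · obtain ⟨s, rfl⟩ := Nat.exists_eq_add_of_le (ht.trans htt)
      rw [H.run_known (by omega)]
      exact Finset.subset_union_left
    · obtain ⟨s, rfl⟩ := Nat.exists_eq_add_of_le h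
      rw [H.chase_known (by omega), merged]
      exact Finset.subset_union_left

/-! ### What the agents know is true -/

/-- The landmark has the given coordinate, where `O` is the origin, `W` the position of the
anchor, and `m` the missing edge of the distinguished round. -/
def Genuine (O W : ZMod n) (m : Option (ZMod n)) (e : Bool × ℤ) : Prop :=
  if e.1 then O + (e.2 : ZMod n) = W else m = some (O + (e.2 : ZMod n))

theorem dvd_of_genuine {O W : ZMod n} {m : Option (ZMod n)} {a b : Bool × ℤ}
    (ha : Genuine O W m a) (hb : Genuine O W m b) (h : a.1 = b.1) : (n : ℤ) ∣ b.2 - a.2 := by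
  have : (a.2 : ZMod n) = b.2 := by
    unfold Genuine at ha hb
    rw [← h] at hb
    cases h1 : a.1
    · rw [h1] at ha hb
      simp only [Bool.false_eq_true, if_false] at ha hb
      rw [ha] at hb
      simpa using hb
    · rw [h1] at ha hb
      simp only [if_true] at ha hb
      rw [← hb] at ha
      simpa using ha
  exact (ZMod.intCast_eq_intCast_iff_dvd_sub _ _ _).mp this

/-- Observations are genuine because coordinates track positions and the anchor rests during the
run; sharing adds nothing new. `hW` is conditional on a mover because without one all three agents
are anchors, possibly at different nodes, and nothing is observed. -/
theorem genuine_of_mem_known (H : PhaseRun n k j ident p miss M f) {O W : ZMod n}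
    (hO : ∀ i, (M (wanderTime k j) i).role ≠ .anchor → p (wanderTime k j) i = O)
    (hW : ∀ i l, (M (wanderTime k j) i).role ≠ .anchor → (M (wanderTime k j) l).role = .anchor →
      p (wanderTime k j) l = W) {t : ℕ} (ht : wanderTime k j ≤ t) (ht' : t < phaseLength k j)
    (i : Fin 3) {e : Bool × ℤ} (he : e ∈ (M t i).known) :
    Genuine O W (miss (wanderTime k j + (2 ^ j - 1))) e := by
  have hl : phaseLength k j = wanderTime k j + 11 * 2 ^ j := rfl
  have hpow : 0 < 2 ^ j := by positivity
  induction t, ht using Nat.le_induction generalizing i with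
  | base => simp [H.wander_known le_rfl] at he
  | succ t ht ih =>
    rcases Nat.lt_or_ge t (wanderTime k j + 2 * 2 ^ j) with h | h
    · obtain ⟨s, rfl⟩ := Nat.exists_eq_add_of_le ht
      rw [H.run_known (by omega), Finset.mem_union, H.mem_observed (by omega)] at he
      rcases he with he | ⟨hi, ⟨⟨l, hla, hlp⟩, rfl⟩ | ⟨⟨rfl, hf⟩, rfl⟩⟩
      · exact ih (by omega) i he
      · simp only [Genuine, if_true]
        rw [← hO i hi, ← H.pos_eq_add_coord (by omega), ← hlp, H.anchor_pos (by omega) hla]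
        exact hW i l hi hla
      · simp only [Genuine, Bool.false_eq_true, if_false]
        -- The flag read in round `2 ^ j` of the run reports the attempt of round `2 ^ j - 1`, and a
        -- failed move leaves the coordinate unchanged.
        obtain ⟨s, hs⟩ : ∃ s, 2 ^ j = s + 1 := ⟨2 ^ j - 1, by omega⟩
        rw [hs] at hf ⊢
        rw [← add_assoc] at hf
        rw [H.run_coord_succ (by omega), hf, if_pos rfl, Nat.add_sub_cancel]
        rw [H.run_failed (by omega), H.pos_eq_add_coord (by omega), hO i hi] at hf
        cases hr : (M (wanderTime k j) i).role
        · simpa [hr, isHit, Role.action, Role.edgeCoord] using hf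
        · simpa [hr, isHit, Role.action, Role.edgeCoord, add_sub_assoc] using hf
        · exact absurd hr hi
    · obtain ⟨s, rfl⟩ := Nat.exists_eq_add_of_le h
      rw [H.chase_known (by omega), mem_merged] at he
      rcases he with he | ⟨m, hm, he⟩
      · exact ih (by omega) i he
      · obtain ⟨l, -, -, rfl⟩ := mem_colocated.mp hm
        exact ih (by omega) l he

/-- As long as the guess is too small, nobody terminates. -/
theorem not_conclusive (H : PhaseRun n k j ident p miss M f) (hw : 0 < wanderTime k j)
    (hinj : Function.Injective ident) (hnj : 2 ^ j < n) (i : Fin 3) :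
    ¬ Conclusive (2 ^ j) (merged (M (phaseLength k j - 1) i)
      (colocated (p (phaseLength k j - 1)) (M (phaseLength k j - 1)) i)) := by
  have hl : phaseLength k j = wanderTime k j + 11 * 2 ^ j := rfl
  have hpow : 0 < 2 ^ j := by positivity
  obtain ⟨O, W, hO, hW⟩ : ∃ O W : ZMod n,
      (∀ i, (M (wanderTime k j) i).role ≠ .anchor → p (wanderTime k j) i = O) ∧
      (∀ i l, (M (wanderTime k j) i).role ≠ .anchor → (M (wanderTime k j) l).role = .anchor →
        p (wanderTime k j) l = W) := by
    by_cases h : ∃ i, (M (wanderTime k j) i).role ≠ .anchor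
    · obtain ⟨i, hi⟩ := h
      obtain ⟨u, v, w, hu, hv, hw', huv⟩ := H.exists_roles_of_ne hw hinj hi
      have cover := fin_three_cover (a := u) (b := v) (c := w) (by rintro rfl; simp_all)
        (by rintro rfl; simp_all) (by rintro rfl; simp_all)
      refine ⟨p (wanderTime k j) u, p (wanderTime k j) w, fun i hi => ?_, fun _ l _ hl => ?_⟩
      · rcases cover i with rfl | rfl | rfl
        · rfl
        · exact huv.symm
        · exact absurd hw' hi
      · rcases cover l with rfl | rfl | rfl
        · simp_all
        · simp_all
        · rfl
    -- With no mover the conditions on `O` and `W` are vacuous, so any values serve.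
    · push Not at h
      exact ⟨0, 0, fun i hi => absurd (h i) hi, fun i _ hi => absurd (h i) hi⟩
  have gen : ∀ e ∈ merged (M (phaseLength k j - 1) i) (colocated (p (phaseLength k j - 1))
      (M (phaseLength k j - 1)) i), Genuine O W (miss (wanderTime k j + (2 ^ j - 1))) e := by
    intro e he
    rcases mem_merged.mp he with he | ⟨m, hm, he⟩
    · exact H.genuine_of_mem_known hO hW (by omega) (by omega) i he
    · obtain ⟨l, -, -, rfl⟩ := mem_colocated.mp hm
      exact H.genuine_of_mem_known hO hW (by omega) (by omega) l he
  rintro ⟨a, ha, b, hb, h1, h2, h3⟩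
  -- The positive difference is a multiple of `n`, yet at most `2 ^ j < n`.
  have := Int.le_of_dvd (by omega) (dvd_of_genuine (gen a ha) (gen b hb) h1)
  push_cast at h3
  have : ((2 ^ j : ℕ) : ℤ) < n := by exact_mod_cast hnj
  push_cast at this
  omega

end PhaseRun

/-- The number of rounds before round `s` that are not marked in `b`. -/
def moves (b : ℕ → Bool) : ℕ → ℕ
  | 0 => 0
  | s + 1 => moves b s + if b s then 0 else 1

namespace PhaseRun

variable {n k j : ℕ} {ident : Fin 3 → ℕ} {p : ℕ → Fin 3 → ZMod n}
  {miss : ℕ → Option (ZMod n)} {M : ℕ → Fin 3 → Memory} {f : ℕ → Fin 3 → Bool}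

/-! ### Exploration and evidence during the run -/

theorem coord_rightward (H : PhaseRun n k j ident p miss M f) {u : Fin 3}
    (hu : (M (wanderTime k j) u).role = .rightward) {s : ℕ} (hs : s < 2 * 2 ^ j) :
    (M (wanderTime k j + s + 1) u).coord =
      moves (fun s => f (wanderTime k j + s + 1) u) s := by
  induction s with
  | zero => simp [H.run_coord_zero, moves]
  | succ s ih =>
    rw [H.run_coord_succ hs, ih (by omega), hu, moves]
    split_ifs <;> simp [Role.shift]

theorem coord_leftward (H : PhaseRun n k j ident p miss M f) {v : Fin 3}
    (hv : (M (wanderTime k j) v).role = .leftward) {s : ℕ} (hs : s < 2 * 2 ^ j) :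
    (M (wanderTime k j + s + 1) v).coord =
      -(moves (fun s => f (wanderTime k j + s + 1) v) s : ℤ) := by
  induction s with
  | zero => simp [H.run_coord_zero, moves]
  | succ s ih =>
    rw [H.run_coord_succ hs, ih (by omega), hv, moves]
    split_ifs <;> simp [Role.shift]
    ring

theorem failed_rightward (H : PhaseRun n k j ident p miss M f) {u : Fin 3}
    (hu : (M (wanderTime k j) u).role = .rightward) {s : ℕ} (hs : s < 2 * 2 ^ j) :
    f (wanderTime k j + s + 1) u = true ↔ miss (wanderTime k j + s) =
      some (p (wanderTime k j) u + moves (fun s => f (wanderTime k j + s + 1) u) s) := by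
  rw [H.run_failed hs, H.pos_eq_add_coord hs, H.coord_rightward hu hs, hu]
  simp [Role.action, isHit]

theorem failed_leftward (H : PhaseRun n k j ident p miss M f) {v : Fin 3}
    (hv : (M (wanderTime k j) v).role = .leftward) {s : ℕ} (hs : s < 2 * 2 ^ j) :
    f (wanderTime k j + s + 1) v = true ↔ miss (wanderTime k j + s) =
      some (p (wanderTime k j) v - moves (fun s => f (wanderTime k j + s + 1) v) s - 1) := by
  rw [H.run_failed hs, H.pos_eq_add_coord hs, H.coord_leftward hv hs, hv]
  simp [Role.action, isHit, sub_eq_add_neg]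

/-- After `x` moves right and `y` moves left from `O`, both movers face the same edge exactly when
the two arcs and that edge close up around the ring. -/
theorem edge_eq_iff (O : ZMod n) (x y : ℕ) : O + (x : ZMod n) = O - y - 1 ↔ n ∣ x + y + 1 := by
  rw [← ZMod.natCast_eq_zero_iff]
  push_cast
  constructor <;> intro h
  · linear_combination h
  · linear_combination h

theorem dvd_of_both_failed (H : PhaseRun n k j ident p miss M f) {u v : Fin 3}
    (hu : (M (wanderTime k j) u).role = .rightward)
    (hv : (M (wanderTime k j) v).role = .leftward)
    (huv : p (wanderTime k j) u = p (wanderTime k j) v) {s : ℕ} (hs : s < 2 * 2 ^ j)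
    (h1 : f (wanderTime k j + s + 1) u = true) (h2 : f (wanderTime k j + s + 1) v = true) :
    n ∣ moves (fun s => f (wanderTime k j + s + 1) u) s +
      moves (fun s => f (wanderTime k j + s + 1) v) s + 1 := by
  rw [H.failed_rightward hu hs] at h1
  rw [H.failed_leftward hv hs, h1, huv, Option.some_inj] at h2
  exact (edge_eq_iff _ _ _).mp h2

theorem failed_iff_of_dvd (H : PhaseRun n k j ident p miss M f) {u v : Fin 3}
    (hu : (M (wanderTime k j) u).role = .rightward)
    (hv : (M (wanderTime k j) v).role = .leftward)
    (huv : p (wanderTime k j) u = p (wanderTime k j) v) {s : ℕ} (hs : s < 2 * 2 ^ j)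
    (h : n ∣ moves (fun s => f (wanderTime k j + s + 1) u) s +
      moves (fun s => f (wanderTime k j + s + 1) v) s + 1) :
    f (wanderTime k j + s + 1) u = true ↔ f (wanderTime k j + s + 1) v = true := by
  rw [H.failed_rightward hu hs, H.failed_leftward hv hs, huv, (edge_eq_iff _ _ _).mpr h]

/-- If the guess is large enough, the run visits all nodes. -/
theorem run_explores (H : PhaseRun n k j ident p miss M f) (hn : 0 < n) (hnj : n ≤ 2 ^ j)
    {u v : Fin 3} (hu : (M (wanderTime k j) u).role = .rightward)
    (hv : (M (wanderTime k j) v).role = .leftward)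
    (huv : p (wanderTime k j) u = p (wanderTime k j) v) (z : ZMod n) :
    ∃ t < phaseLength k j, ∃ i, p t i = z := by
  have hl : phaseLength k j = wanderTime k j + 11 * 2 ^ j := rfl
  have : NeZero n := ⟨hn.ne'⟩
  -- After `n - 1` rounds the arcs swept to the right and to the left have total length at least `n
  -- - 1`, so they cover all `n` nodes.
  have htot := le_total_moves (T := 2 * 2 ^ j)
    (x := moves fun s => f (wanderTime k j + s + 1) u)
    (y := moves fun s => f (wanderTime k j + s + 1) v) (fun s _ => rfl) (fun s _ => rfl)
    (fun s hs => H.dvd_of_both_failed hu hv huv hs) (n - 1) (by omega)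
  have step : ∀ b : ℕ → Bool, ∀ i < n - 1, moves b (i + 1) ≤ moves b i + 1 := by
    intro b i _
    rw [moves]; split_ifs <;> omega
  have hr := ZMod.val_lt (z - p (wanderTime k j) u)
  have hz : z = p (wanderTime k j) u + ((z - p (wanderTime k j) u).val : ZMod n) := by
    rw [ZMod.natCast_zmod_val]; ring
  set r := (z - p (wanderTime k j) u).val
  by_cases h : r ≤ moves (fun s => f (wanderTime k j + s + 1) u) (n - 1)
  · obtain ⟨i, hi, he⟩ := exists_eq_of_le rfl (step _) h
    refine ⟨wanderTime k j + i, by omega, u, ?_⟩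
    rw [H.pos_eq_add_coord (by omega), H.coord_rightward hu (by omega), he, hz]
    push_cast; rfl
  · have h' : n - r ≤ moves (fun s => f (wanderTime k j + s + 1) v) (n - 1) := by omega
    obtain ⟨i, hi, he⟩ := exists_eq_of_le rfl (step _) h'
    refine ⟨wanderTime k j + i, by omega, v, ?_⟩
    rw [H.pos_eq_add_coord (by omega), H.coord_leftward hv (by omega), he, hz, ← huv]
    rw [Nat.cast_sub hr.le]
    simp

theorem mem_known_of_sight (H : PhaseRun n k j ident p miss M f) {i w : Fin 3}
    (hi : (M (wanderTime k j) i).role ≠ .anchor) (hw : (M (wanderTime k j) w).role = .anchor)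
    {s : ℕ} (hs : s < 2 * 2 ^ j) (hp : p (wanderTime k j) w = p (wanderTime k j) i +
      ((M (wanderTime k j + s + 1) i).coord : ZMod n)) :
    (true, (M (wanderTime k j + s + 1) i).coord) ∈
      (M (wanderTime k j + 2 * 2 ^ j) i).known := by
  have hl : phaseLength k j = wanderTime k j + 11 * 2 ^ j := rfl
  apply H.known_mono (t := wanderTime k j + s + 1) (by omega) (by omega) (by omega) i
  rw [H.run_known hs, Finset.mem_union, H.mem_observed hs]
  exact Or.inr ⟨hi, Or.inl ⟨⟨w, hw, by rw [H.anchor_pos hs hw, H.pos_eq_add_coord hs, hp]⟩, rfl⟩⟩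

theorem mem_known_of_failed (H : PhaseRun n k j ident p miss M f) {i : Fin 3}
    (hi : (M (wanderTime k j) i).role ≠ .anchor)
    (hf : f (wanderTime k j + (2 ^ j - 1) + 1) i = true) :
    (false, (M (wanderTime k j) i).role.edgeCoord
      (M (wanderTime k j + (2 ^ j - 1) + 1) i).coord) ∈
      (M (wanderTime k j + 2 * 2 ^ j) i).known := by
  have hl : phaseLength k j = wanderTime k j + 11 * 2 ^ j := rfl
  have hpow : 0 < 2 ^ j := by positivity
  apply H.known_mono (t := wanderTime k j + 2 ^ j + 1) (by omega) (by omega) (by omega) i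
  rw [H.run_known (by omega), Finset.mem_union, H.mem_observed (by omega)]
  refine Or.inr ⟨hi, Or.inr ⟨⟨rfl, ?_⟩, ?_⟩⟩
  · rwa [show wanderTime k j + 2 ^ j = wanderTime k j + (2 ^ j - 1) + 1 by omega]
  · have := H.run_coord_succ (s := 2 ^ j - 1) (by omega) i
    rw [hf, if_pos rfl, show 2 ^ j - 1 + 1 = 2 ^ j by omega] at this
    rw [this]

/-- If the guess is large enough, then after the run the two agents that moved have together
enough evidence. -/
theorem run_conclusive (H : PhaseRun n k j ident p miss M f) (hn : 0 < n) (hnj : n ≤ 2 ^ j)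
    {u v w : Fin 3} (hu : (M (wanderTime k j) u).role = .rightward)
    (hv : (M (wanderTime k j) v).role = .leftward) (hw : (M (wanderTime k j) w).role = .anchor)
    (huv : p (wanderTime k j) u = p (wanderTime k j) v) :
    Conclusive (2 ^ j) ((M (wanderTime k j + 2 * 2 ^ j) u).known ∪
      (M (wanderTime k j + 2 * 2 ^ j) v).known) := by
  have hpow : 0 < 2 ^ j := by positivity
  have : NeZero n := ⟨hn.ne'⟩
  have hnj' : (n : ℤ) ≤ ((2 ^ j : ℕ) : ℤ) := by exact_mod_cast hnj
  have hua : (M (wanderTime k j) u).role ≠ .anchor := by rw [hu]; decide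
  have hva : (M (wanderTime k j) v).role ≠ .anchor := by rw [hv]; decide
  have hr := ZMod.val_lt (p (wanderTime k j) w - p (wanderTime k j) u)
  have hz : p (wanderTime k j) w = p (wanderTime k j) u +
      ((p (wanderTime k j) w - p (wanderTime k j) u).val : ZMod n) := by
    rw [ZMod.natCast_zmod_val]; ring
  set r := (p (wanderTime k j) w - p (wanderTime k j) u).val
  have seen_u : ∀ s < 2 * 2 ^ j, ∀ c : ℕ,
      moves (fun s => f (wanderTime k j + s + 1) u) s = c → (c : ZMod n) = r →
      (true, (c : ℤ)) ∈ (M (wanderTime k j + 2 * 2 ^ j) u).known ∪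
        (M (wanderTime k j + 2 * 2 ^ j) v).known := by
    intro s hs c hc hcr
    have hcoord := H.coord_rightward hu hs
    rw [hc] at hcoord
    have := H.mem_known_of_sight hua hw hs (by rw [hcoord, hz]; simp [hcr])
    rw [hcoord] at this
    exact Finset.mem_union_left _ this
  have seen_v : ∀ s < 2 * 2 ^ j, ∀ c : ℕ,
      moves (fun s => f (wanderTime k j + s + 1) v) s = c → (-c : ZMod n) = r →
      (true, -(c : ℤ)) ∈ (M (wanderTime k j + 2 * 2 ^ j) u).known ∪
        (M (wanderTime k j + 2 * 2 ^ j) v).known := by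
    intro s hs c hc hcr
    have hcoord := H.coord_leftward hv hs
    rw [hc] at hcoord
    have := H.mem_known_of_sight hva hw hs (by rw [hcoord, hz, huv]; simp [hcr])
    rw [hcoord] at this
    exact Finset.mem_union_right _ this
  rcases exists_evidence (N := 2 ^ j) (w := r) hnj hr
    (x := moves fun s => f (wanderTime k j + s + 1) u)
    (y := moves fun s => f (wanderTime k j + s + 1) v) rfl rfl (fun s _ => rfl) (fun s _ => rfl)
    (fun s hs => H.dvd_of_both_failed hu hv huv hs)
    (fun s hs => H.failed_iff_of_dvd hu hv huv hs) with
    ⟨h1, h2, h3⟩ | ⟨s, hs, s', hs', h1, h2⟩ | ⟨s, hs, s', hs', h1, h2⟩ | ⟨s, hs, s', hs', h1, h2⟩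
  -- The common edge has coordinate `x` for the right mover and `-y - 1` for the left one; these
  -- differ by `x + y + 1 = n`.
  · have e1 := H.mem_known_of_failed hua h1
    have e2 := H.mem_known_of_failed hva h2
    rw [H.coord_rightward hu (by omega), hu] at e1
    rw [H.coord_leftward hv (by omega), hv] at e2
    refine ⟨_, Finset.mem_union_right _ e2, _, Finset.mem_union_left _ e1, rfl, ?_, ?_⟩ <;>
      simp only [Role.edgeCoord] <;> omega
  · refine ⟨_, seen_v s' hs' _ h2 ?_, _, seen_u s hs _ h1 rfl, rfl, ?_, ?_⟩
    · rw [Nat.cast_sub hr.le]; simp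
    all_goals simp only; omega
  · refine ⟨_, seen_u s hs _ h1 rfl, _, seen_u s' hs' _ h2 (by simp), rfl, ?_, ?_⟩
    all_goals simp only; omega
  · refine ⟨_, seen_v s' hs' _ h2 ?_, _, seen_v s hs _ h1 ?_, rfl, ?_, ?_⟩
    · rw [Nat.cast_add, Nat.cast_sub hr.le]; simp
    · rw [Nat.cast_sub hr.le]; simp
    all_goals simp only; omega

/-! ### The exchange of information during the chases -/

/-- `exists_contact` inside the `q`-th chase. The slack of two rounds leaves time to process the
contact before the chase ends, even when the last round of the phase is reserved for `conclude`. -/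
theorem exists_contact_in_chase (H : PhaseRun n k j ident p miss M f) (hn : 0 < n)
    (hnj : n ≤ 2 ^ j) {q : ℕ} (hq : q < 3) {b c : Fin 3}
    (hinj : Function.Injective fun i => (M (wanderTime k j) i).role)
    (hc : (M (wanderTime k j) c).role = chaseAnchor q) (hbc : b ≠ c) :
    ∃ s, 3 * 2 ^ j * q ≤ s ∧ s + 2 < 3 * 2 ^ j * (q + 1) ∧ ∃ a, a ≠ b ∧
      p (wanderTime k j + 2 * 2 ^ j + s) a = p (wanderTime k j + 2 * 2 ^ j + s) b := by
  have : NeZero n := ⟨hn.ne'⟩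
  have hq' : 3 * 2 ^ j * (q + 1) ≤ 9 * 2 ^ j := by
    calc 3 * 2 ^ j * (q + 1) ≤ 3 * 2 ^ j * 3 := Nat.mul_le_mul_left _ hq
      _ = 9 * 2 ^ j := by ring
  rw [Nat.mul_add, mul_one] at hq' ⊢
  obtain ⟨a, hab, hac⟩ : ∃ a, a ≠ b ∧ a ≠ c := by
    clear hc
    revert b c; decide
  have slot : ∀ s < 3 * (n - 1), (3 * 2 ^ j * q + s) / (3 * 2 ^ j) = q := by
    intro s hs
    rw [Nat.mul_add_div (by positivity), Nat.div_eq_of_lt (by omega), add_zero]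
  have step : ∀ i, ∀ s < 3 * (n - 1), p (wanderTime k j + 2 * 2 ^ j + (3 * 2 ^ j * q + (s + 1))) i =
      moveTo (miss (wanderTime k j + 2 * 2 ^ j + (3 * 2 ^ j * q + s)))
        (p (wanderTime k j + 2 * 2 ^ j + (3 * 2 ^ j * q + s)) i)
        (if i = c then .stay else .right) := by
    intro i s hs
    rw [← add_assoc (3 * 2 ^ j * q), ← add_assoc _ _ 1, H.chase_pos (by omega), slot s hs, ← hc]
    simp only [hinj.eq_iff]
  obtain ⟨s, hs, h⟩ := exists_contact
    (fun s => miss (wanderTime k j + 2 * 2 ^ j + (3 * 2 ^ j * q + s)))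
    (fun s => p (wanderTime k j + 2 * 2 ^ j + (3 * 2 ^ j * q + s)) a)
    (fun s => p (wanderTime k j + 2 * 2 ^ j + (3 * 2 ^ j * q + s)) b)
    (fun s => p (wanderTime k j + 2 * 2 ^ j + (3 * 2 ^ j * q + s)) c)
    (fun s hs => by have := step a s hs; rwa [if_neg hac] at this)
    (fun s hs => by have := step b s hs; rwa [if_neg hbc] at this)
    (fun s hs => by have := step c s hs; rwa [if_pos rfl] at this)
  refine ⟨3 * 2 ^ j * q + s, by omega, by omega, ?_⟩
  rcases h with h | h
  · exact ⟨a, hab, h.symm⟩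
  · exact ⟨c, hbc.symm, h.symm⟩

theorem known_subset_of_contact (H : PhaseRun n k j ident p miss M f) {s s' : ℕ}
    (hss : s < s') (hs : s' < 9 * 2 ^ j) {i l : Fin 3} (hil : i ≠ l)
    (hp : p (wanderTime k j + 2 * 2 ^ j + s) i = p (wanderTime k j + 2 * 2 ^ j + s) l) :
    (M (wanderTime k j + 2 * 2 ^ j + s) i).known ⊆
      (M (wanderTime k j + 2 * 2 ^ j + s') l).known := by
  have hl : phaseLength k j = wanderTime k j + 11 * 2 ^ j := rfl
  refine subset_trans ?_ (H.known_mono (t := wanderTime k j + 2 * 2 ^ j + s + 1) (by omega)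
    (by omega) (by omega) l)
  rw [H.chase_known (by omega)]
  intro e he
  exact mem_merged.mpr (Or.inr ⟨_, mem_colocated.mpr ⟨i, hil, hp, rfl⟩, he⟩)

/-- After the chases everybody knows what the two agents that moved knew after the run. -/
theorem chase_known_subset (H : PhaseRun n k j ident p miss M f) (hn : 0 < n) (hnj : n ≤ 2 ^ j)
    {u v w : Fin 3} (hu : (M (wanderTime k j) u).role = .rightward)
    (hv : (M (wanderTime k j) v).role = .leftward) (hw : (M (wanderTime k j) w).role = .anchor)
    (i : Fin 3) :
    (M (wanderTime k j + 2 * 2 ^ j) u).known ∪ (M (wanderTime k j + 2 * 2 ^ j) v).known ⊆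
      (M (phaseLength k j - 1) i).known := by
  have hl : phaseLength k j = wanderTime k j + 11 * 2 ^ j := rfl
  have hpow : 0 < 2 ^ j := by positivity
  have huv : u ≠ v := by rintro rfl; simp_all
  have huw : u ≠ w := by rintro rfl; simp_all
  have hvw : v ≠ w := by rintro rfl; simp_all
  have cover := fin_three_cover huv huw hvw
  have hinj : Function.Injective fun i => (M (wanderTime k j) i).role := by
    intro a b h
    rcases cover a with rfl | rfl | rfl <;> rcases cover b with rfl | rfl | rfl <;> simp_all
  set I := (M (wanderTime k j + 2 * 2 ^ j) u).known ∪ (M (wanderTime k j + 2 * 2 ^ j) v).known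
    with hI
  have mono : ∀ {s s' : ℕ} (l : Fin 3), s ≤ s' → s' < 9 * 2 ^ j →
      (M (wanderTime k j + 2 * 2 ^ j + s) l).known ⊆
        (M (wanderTime k j + 2 * 2 ^ j + s') l).known := fun l h1 h2 =>
    H.known_mono (by omega) (by omega) (by omega) l
  -- In the first chase both movers of the run make contact. Either they meet each other, or each
  -- meets the anchor, which relays the knowledge of the earlier visitor to the later one.
  have two : ∃ a b, a ≠ b ∧ I ⊆ (M (wanderTime k j + 2 * 2 ^ j + 3 * 2 ^ j) a).known ∧
      I ⊆ (M (wanderTime k j + 2 * 2 ^ j + 3 * 2 ^ j) b).known := by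
    have direct : ∀ s, s + 2 < 3 * 2 ^ j →
        p (wanderTime k j + 2 * 2 ^ j + s) u = p (wanderTime k j + 2 * 2 ^ j + s) v →
        ∃ a b, a ≠ b ∧ I ⊆ (M (wanderTime k j + 2 * 2 ^ j + 3 * 2 ^ j) a).known ∧
          I ⊆ (M (wanderTime k j + 2 * 2 ^ j + 3 * 2 ^ j) b).known := by
      intro s hs hp
      refine ⟨u, v, huv, Finset.union_subset ?_ ?_, Finset.union_subset ?_ ?_⟩
      · exact mono (s := 0) u (by omega) (by omega)
      · exact (mono (s := 0) v (Nat.zero_le s) (by omega)).trans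
          (H.known_subset_of_contact (by omega) (by omega) huv.symm hp.symm)
      · exact (mono (s := 0) u (Nat.zero_le s) (by omega)).trans
          (H.known_subset_of_contact (by omega) (by omega) huv hp)
      · exact mono (s := 0) v (by omega) (by omega)
    have relay : ∀ x y, x ≠ y → x ≠ w → y ≠ w → ∀ s s', s ≤ s' → s' + 2 < 3 * 2 ^ j →
        p (wanderTime k j + 2 * 2 ^ j + s) w = p (wanderTime k j + 2 * 2 ^ j + s) x →
        p (wanderTime k j + 2 * 2 ^ j + s') w = p (wanderTime k j + 2 * 2 ^ j + s') y →
        (M (wanderTime k j + 2 * 2 ^ j) x).known ∪ (M (wanderTime k j + 2 * 2 ^ j) y).known ⊆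
            (M (wanderTime k j + 2 * 2 ^ j + 3 * 2 ^ j) w).known ∧
        (M (wanderTime k j + 2 * 2 ^ j) x).known ∪ (M (wanderTime k j + 2 * 2 ^ j) y).known ⊆
            (M (wanderTime k j + 2 * 2 ^ j + 3 * 2 ^ j) y).known := by
      intro x y hxy hxw hyw s s' hss hs hp hp'
      have hx : (M (wanderTime k j + 2 * 2 ^ j) x).known ⊆
          (M (wanderTime k j + 2 * 2 ^ j + (s + 1)) w).known :=
        (mono (s := 0) x (Nat.zero_le s) (by omega)).trans
          (H.known_subset_of_contact (by omega) (by omega) hxw hp.symm)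
      have hy : (M (wanderTime k j + 2 * 2 ^ j) y).known ⊆
          (M (wanderTime k j + 2 * 2 ^ j + 3 * 2 ^ j) w).known :=
        (mono (s := 0) y (Nat.zero_le s') (by omega)).trans
          (H.known_subset_of_contact (by omega) (by omega) hyw hp'.symm)
      refine ⟨Finset.union_subset (hx.trans (mono w (by omega) (by omega))) hy,
        Finset.union_subset ?_ (mono (s := 0) y (by omega) (by omega))⟩
      -- Knowledge travels one hop per round, so the anchor can relay only from a strictly earlier
      -- visit; visits in the same round put `x` and `y` at one node, where they exchange directly.
      rcases eq_or_lt_of_le hss with rfl | hlt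
      · exact (mono (s := 0) x (Nat.zero_le s) (by omega)).trans
          (H.known_subset_of_contact (by omega) (by omega) hxy (hp.symm.trans hp'))
      · exact (hx.trans (mono w (show s + 1 ≤ s' by omega) (by omega))).trans
          (H.known_subset_of_contact (by omega) (by omega) hyw.symm hp')
    obtain ⟨s, -, hs, a, ha, hp⟩ := H.exists_contact_in_chase hn hnj (q := 0) (by omega) hinj hw huw
    obtain ⟨s', -, hs', b, hb, hp'⟩ :=
      H.exists_contact_in_chase hn hnj (q := 0) (by omega) hinj hw hvw
    simp only [zero_add, mul_one] at hs hs'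
    rcases cover a with rfl | rfl | rfl
    · exact absurd rfl ha
    · exact direct s hs hp.symm
    rcases cover b with rfl | rfl | rfl
    · exact direct s' hs' hp'
    · exact absurd rfl hb
    rcases le_total s s' with h | h
    · exact ⟨_, _, hvw.symm, relay u v huv huw hvw s s' h hs' hp hp'⟩
    · have := relay v u huv.symm hvw huw s' s h hs hp' hp
      rw [Finset.union_comm] at this
      exact ⟨_, _, huw.symm, this⟩
  obtain ⟨a, b, hab, ha, hb⟩ := two
  rw [show phaseLength k j - 1 = wanderTime k j + 2 * 2 ^ j + (9 * 2 ^ j - 1) by omega]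
  by_cases hia : i = a
  · subst hia
    exact ha.trans (mono i (by omega) (by omega))
  by_cases hib : i = b
  · subst hib
    exact hb.trans (mono i (by omega) (by omega))
  -- The agent still uninformed moves in at least one of the two later chases, and both possible
  -- partners are informed.
  obtain ⟨q, c, hq, hq', hc, hic⟩ : ∃ q c, 1 ≤ q ∧ q < 3 ∧
      (M (wanderTime k j) c).role = chaseAnchor q ∧ i ≠ c := by
    by_cases hiv : i = v
    · exact ⟨2, u, by omega, by omega, hu, by rw [hiv]; exact huv.symm⟩
    · exact ⟨1, v, by omega, by omega, hv, hiv⟩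
  obtain ⟨s, hs, hs', x, hx, hp⟩ := H.exists_contact_in_chase hn hnj hq' hinj hc hic
  have h1 : 3 * 2 ^ j * 1 ≤ 3 * 2 ^ j * q := Nat.mul_le_mul_left _ hq
  have h2 : 3 * 2 ^ j * (q + 1) ≤ 3 * 2 ^ j * 3 := Nat.mul_le_mul_left _ hq'
  refine subset_trans ?_ (H.known_subset_of_contact (s' := 9 * 2 ^ j - 1) (by omega) (by omega)
    hx hp)
  rcases fin_three_cover hab (Ne.symm hia) (Ne.symm hib) x with rfl | rfl | rfl
  · exact ha.trans (mono x (by omega) (by omega))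
  · exact hb.trans (mono x (by omega) (by omega))
  · exact absurd rfl hx

/-- If the guess is large enough, then the phase explores the ring, and at its end everybody knows
that the guess is large enough. -/
theorem explores_and_concludes (H : PhaseRun n k j ident p miss M f) (hw : 0 < wanderTime k j)
    (hinj : Function.Injective ident) (hlt : ∀ i, ident i < 2 ^ k) (hn : 0 < n)
    (hnj : n ≤ 2 ^ j) :
    (∀ z, ∃ t < phaseLength k j, ∃ i, p t i = z) ∧
    ∀ i, Conclusive (2 ^ j) (merged (M (phaseLength k j - 1) i)
      (colocated (p (phaseLength k j - 1)) (M (phaseLength k j - 1)) i)) := by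
  obtain ⟨i, l, hil, hp⟩ := H.exists_meeting hn hnj hinj hlt
  rw [← H.assign_pos hw, ← H.assign_pos hw] at hp
  obtain ⟨u, v, w, hu, hv, hw', huv⟩ := H.exists_roles hw hinj hil hp
  refine ⟨H.run_explores hn hnj hu hv huv, fun i => ?_⟩
  exact (H.run_conclusive hn hnj hu hv hw' huv).mono
    ((H.chase_known_subset hn hnj hu hv hw' i).trans Finset.subset_union_left)

end PhaseRun

/-! ### Coordinates in which right is clockwise -/

/-- The node `v`, in coordinates in which the direction `o` is clockwise. -/
def chart {n : ℕ} : Rotation → ZMod n → ZMod n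
  | .clockwise, v => v
  | .counterclockwise, v => -v

/-- The missing edge, in coordinates in which the direction `o` is clockwise. -/
def chartEdge {n : ℕ} : Rotation → Option (ZMod n) → Option (ZMod n)
  | .clockwise, m => m
  | .counterclockwise, m => m.map fun e => -e - 1

theorem chart_chart {n : ℕ} (o : Rotation) (v : ZMod n) : chart o (chart o v) = v := by
  cases o <;> simp [chart]

theorem chart_injective {n : ℕ} (o : Rotation) : Function.Injective (chart (n := n) o) :=
  Function.LeftInverse.injective (chart_chart o)

theorem chartEdge_eq_some {n : ℕ} (m : Option (ZMod n)) (v : ZMod n) :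
    chartEdge .counterclockwise m = some v ↔ m = some (-v - 1) := by
  simp only [chartEdge, Option.map_eq_some_iff]
  constructor
  · rintro ⟨e, rfl, rfl⟩
    congr 1; ring
  · rintro rfl
    exact ⟨_, rfl, by ring⟩

theorem chart_destination {n : ℕ} (o : Rotation) (m : Option (ZMod n)) (v : ZMod n) (a : Action) :
    chart o (destination m v (heading o a)) = moveTo (chartEdge o m) (chart o v) a := by
  cases o
  · cases a <;> rfl
  · have h1 : chartEdge .counterclockwise m = some (-v) ↔ m = some (v - 1) := by
      rw [chartEdge_eq_some, neg_neg]
    have h2 : chartEdge .counterclockwise m = some (-v - 1) ↔ m = some v := by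
      rw [chartEdge_eq_some, neg_sub, sub_neg_eq_add, add_sub_cancel_left]
    cases a
    · rfl
    · change -(if m = some v then v else v + 1) = if chartEdge .counterclockwise m = some (-v - 1)
        then -v else -v - 1
      by_cases h : m = some v
      · rw [if_pos h, if_pos (h2.mpr h)]
      · rw [if_neg h, if_neg (h2.not.mpr h)]; ring
    · change -(if m = some (v - 1) then v else v - 1) = if chartEdge .counterclockwise m = some (-v)
        then -v else -v + 1
      by_cases h : m = some (v - 1)
      · rw [if_pos h, if_pos (h1.mpr h)]
      · rw [if_neg h, if_neg (h1.not.mpr h)]; ring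
    · rfl

theorem blocked_heading {n : ℕ} (o : Rotation) (m : Option (ZMod n)) (v : ZMod n) (a : Action) :
    blocked m v (heading o a) = isHit (chartEdge o m) (chart o v) a := by
  cases o
  · cases a <;> rfl
  · cases a
    · rfl
    · refine decide_eq_decide.mpr ?_
      rw [chart, chartEdge_eq_some, neg_sub, sub_neg_eq_add, add_sub_cancel_left]
      rfl
    · refine decide_eq_decide.mpr ?_
      rw [chart, chartEdge_eq_some, neg_neg]
      rfl
    · rfl

/-! ### The phases of a run -/

theorem exploreCompute_ne_terminate {m : Memory} {b : Bool} {r : Multiset Memory}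
    (h : m.clock + 1 < phaseLength m.len m.phase) :
    (exploreCompute m b r).2 ≠ .terminate := by
  unfold exploreCompute
  split_ifs
  · unfold wander; dsimp only; split_ifs <;> simp
  · simp [assign]
  · unfold explore; cases m.role <;> simp [Role.action]
  · unfold chase; dsimp only; split_ifs <;> simp

section Phases

variable {n k : ℕ} {ident : Fin 3 → Fin k → Bool} {orient : Fin 3 → Rotation}
  {start : Fin 3 → ZMod n} {missing : ℕ → Option (ZMod n)} {o : Rotation}

/-- Messages depend only on which agents share a node, and the reflection `chart` is injective. -/
theorem decision_eq {c : Config explorer n} (o : Rotation)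
    (hc : ∀ i, c.terminated i = false) (i : Fin 3) : explorer.decision c i =
      exploreCompute (c.mem i) (c.failed i)
        (colocated (fun l => chart o (c.pos l)) c.mem i) := by
  unfold Algorithm.decision Algorithm.received colocated
  simp only [hc, true_and, (chart_injective o).eq_iff]
  rfl

theorem round_of_active {c : Config explorer n} (ho : ∀ i, orient i = o)
    (m : Option (ZMod n)) (hc : ∀ i, c.terminated i = false) (i : Fin 3) :
    (explorer.round orient m c).mem i = (exploreCompute (c.mem i) (c.failed i)
        (colocated (fun l => chart o (c.pos l)) c.mem i)).1 ∧
    chart o ((explorer.round orient m c).pos i) = moveTo (chartEdge o m) (chart o (c.pos i))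
      (exploreCompute (c.mem i) (c.failed i)
        (colocated (fun l => chart o (c.pos l)) c.mem i)).2 ∧
    (explorer.round orient m c).failed i = isHit (chartEdge o m) (chart o (c.pos i))
      (exploreCompute (c.mem i) (c.failed i)
        (colocated (fun l => chart o (c.pos l)) c.mem i)).2 ∧
    (explorer.round orient m c).terminated i = decide ((exploreCompute (c.mem i) (c.failed i)
        (colocated (fun l => chart o (c.pos l)) c.mem i)).2 = .terminate) := by
  simp only [Algorithm.round, hc, ho, decision_eq o hc, Bool.false_eq_true, if_false,
    chart_destination, blocked_heading, Bool.false_or, and_self]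

/-- All agents are active and begin phase `j`. -/
def BeginsPhase (c : Config explorer n) (ident : Fin 3 → Fin k → Bool) (j : ℕ) : Prop :=
  ∀ i, c.terminated i = false ∧ c.mem i = Memory.fresh k (Nat.ofBits (ident i)) j

theorem active_of_beginsPhase (ho : ∀ i, orient i = o) {S j : ℕ}
    (h : BeginsPhase (explorer.run ident orient start missing S) ident j) {t : ℕ}
    (ht : t < phaseLength k j) (i : Fin 3) :
    (explorer.run ident orient start missing (S + t)).terminated i = false ∧
    ((explorer.run ident orient start missing (S + t)).mem i).len = k ∧
    ((explorer.run ident orient start missing (S + t)).mem i).phase = j ∧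
    ((explorer.run ident orient start missing (S + t)).mem i).clock = t := by
  induction t generalizing i with
  | zero =>
    obtain ⟨h1, h2⟩ := h i
    rw [add_zero]
    refine ⟨h1, ?_⟩
    rw [h2]
    exact ⟨rfl, rfl, rfl⟩
  | succ t ih =>
    have ih := fun i => ih (by omega) i
    obtain ⟨e1, -, -, e4⟩ := round_of_active ho (missing (S + t)) (fun i => (ih i).1) i
    obtain ⟨-, h2, h3, h4⟩ := ih i
    rw [← add_assoc]
    have hlt : ((explorer.run ident orient start missing (S + t)).mem i).clock + 1 <
        phaseLength ((explorer.run ident orient start missing (S + t)).mem i).len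
          ((explorer.run ident orient start missing (S + t)).mem i).phase := by
      rw [h2, h3, h4]; exact ht
    obtain ⟨g1, -, g3, g4⟩ := exploreCompute_header
      (b := (explorer.run ident orient start missing (S + t)).failed i)
      (r := colocated (fun l => chart o ((explorer.run ident orient start missing (S + t)).pos l))
        (explorer.run ident orient start missing (S + t)).mem i) hlt
    refine ⟨?_, ?_, ?_, ?_⟩
    · exact e4.trans (decide_eq_false (exploreCompute_ne_terminate hlt))
    · exact (congrArg Memory.len e1).trans (g1.trans h2)
    · exact (congrArg Memory.phase e1).trans (g3.trans h3)
    · exact (congrArg Memory.clock e1).trans (g4.trans (by rw [h4]))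

theorem phaseRun_of_beginsPhase (ho : ∀ i, orient i = o) {S j : ℕ}
    (h : BeginsPhase (explorer.run ident orient start missing S) ident j) :
    PhaseRun n k j (fun i => Nat.ofBits (ident i))
      (fun t i => chart o ((explorer.run ident orient start missing (S + t)).pos i))
      (fun t => chartEdge o (missing (S + t)))
      (fun t => (explorer.run ident orient start missing (S + t)).mem)
      (fun t => (explorer.run ident orient start missing (S + t)).failed) where
  start i := (h i).2
  mem_succ _ ht i := (round_of_active ho _ (fun i => (active_of_beginsPhase ho h ht i).1) i).1
  pos_succ _ ht i := (round_of_active ho _ (fun i => (active_of_beginsPhase ho h ht i).1) i).2.1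
  failed_succ _ ht i :=
    (round_of_active ho _ (fun i => (active_of_beginsPhase ho h ht i).1) i).2.2.1

/-- Memory is reset by `conclude` whether or not the agent terminates, so the first part needs no
case distinction. -/
theorem end_of_phase (ho : ∀ i, orient i = o) {S j : ℕ}
    (h : BeginsPhase (explorer.run ident orient start missing S) ident j) (i : Fin 3) :
    (explorer.run ident orient start missing (S + phaseLength k j)).mem i =
      Memory.fresh k (Nat.ofBits (ident i)) (j + 1) ∧
    ((explorer.run ident orient start missing (S + phaseLength k j)).terminated i = true ↔
      Conclusive (2 ^ j) (merged
        ((explorer.run ident orient start missing (S + (phaseLength k j - 1))).mem i)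
        (colocated (fun l => chart o
          ((explorer.run ident orient start missing (S + (phaseLength k j - 1))).pos l))
        (explorer.run ident orient start missing (S + (phaseLength k j - 1))).mem i))) := by
  have hl : phaseLength k j = wanderTime k j + 11 * 2 ^ j := rfl
  have hpow : 0 < 2 ^ j := by positivity
  have H := phaseRun_of_beginsPhase ho h
  have hc := H.compute_eq (t := phaseLength k j - 1) (by omega) i
  rw [if_neg (by omega), if_neg (by omega), if_neg (by omega), if_neg (by omega)] at hc
  obtain ⟨g1, g2, g3, -⟩ := H.header (t := phaseLength k j - 1) (by omega) i
  obtain ⟨e1, -, -, e4⟩ := round_of_active ho (missing (S + (phaseLength k j - 1)))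
    (fun i => (active_of_beginsPhase ho h (t := phaseLength k j - 1) (by omega) i).1) i
  rw [hc] at e1 e4
  rw [show S + phaseLength k j = S + (phaseLength k j - 1) + 1 by omega, Algorithm.run]
  refine ⟨e1.trans (by simp only [conclude, g1, g2, g3]; rfl), ?_⟩
  rw [e4, decide_eq_true_iff]
  simp only [conclude, g3]
  split_ifs with hcon <;> simp [hcon]

/-! ### The number of rounds and the conclusion -/

/-- The round in which phase `j` begins. -/
def phaseStart (k j : ℕ) : ℕ := (3 * 2 ^ k + 8) * (2 ^ j - 1)

theorem phaseLength_eq (k j : ℕ) : phaseLength k j = (3 * 2 ^ k + 8) * 2 ^ j := by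
  have h : 1 ≤ 2 ^ k := Nat.one_le_two_pow
  unfold phaseLength wanderTime
  zify [h]
  ring

theorem phaseStart_succ (k j : ℕ) : phaseStart k (j + 1) = phaseStart k j + phaseLength k j := by
  have h : 1 ≤ 2 ^ j := Nat.one_le_two_pow
  have h' : 1 ≤ 2 ^ (j + 1) := Nat.one_le_two_pow
  rw [phaseLength_eq, phaseStart, phaseStart]
  zify [h, h']
  ring

theorem wanderTime_pos {k : ℕ} (hk : 1 < k) (j : ℕ) : 0 < wanderTime k j := by
  have : 1 < 2 ^ k := Nat.one_lt_two_pow (by omega)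
  have : 0 < 2 ^ k - 1 := by omega
  unfold wanderTime
  positivity

theorem ofBits_injective : Function.Injective (Nat.ofBits : (Fin k → Bool) → ℕ) := by
  intro a b h
  funext i
  rw [← Nat.testBit_ofBits_lt a i i.2, h, Nat.testBit_ofBits_lt]

/-- `Nat.clog 2 n` is the first phase whose guess reaches `n`; before it, soundness keeps everybody
active. -/
theorem beginsPhase (hk : 1 < k) (hid : Function.Injective ident) (ho : ∀ i, orient i = o)
    {j : ℕ} (hj : j ≤ Nat.clog 2 n) :
    BeginsPhase (explorer.run ident orient start missing (phaseStart k j)) ident j := by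
  induction j with
  | zero => intro i; exact ⟨rfl, rfl⟩
  | succ j ih =>
    have ih := ih (by omega)
    intro i
    obtain ⟨h1, h2⟩ := end_of_phase ho ih i
    rw [phaseStart_succ]
    refine ⟨?_, h1⟩
    rw [← Bool.not_eq_true, h2]
    exact (phaseRun_of_beginsPhase ho ih).not_conclusive (wanderTime_pos hk j)
      (ofBits_injective.comp hid) ((Nat.lt_clog_iff_pow_lt (by norm_num)).mp hj) i

theorem terminated_mono {c : ℕ → Config explorer n}
    (hc : c = explorer.run ident orient start missing) {t t' : ℕ} (htt : t ≤ t') {i : Fin 3}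
    (h : (c t).terminated i = true) : (c t').terminated i = true := by
  induction t', htt using Nat.le_induction with
  | base => exact h
  | succ t' _ ih =>
    subst hc
    simp [Algorithm.run, Algorithm.round, ih]

theorem two_pow_clog_le {n : ℕ} (hn : 3 ≤ n) : 2 ^ Nat.clog 2 n ≤ 2 * n := by
  have := Nat.pow_pred_clog_lt_self (b := 2) (by norm_num) (show 1 < n by omega)
  have hpos : 0 < Nat.clog 2 n := Nat.clog_pos (by norm_num) (by omega)
  rw [show Nat.clog 2 n = (Nat.clog 2 n).pred + 1 by
    rw [Nat.pred_eq_sub_one]; omega, pow_succ]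
  omega

/-- With `P = 2 ^ Nat.clog 2 n`, the term `16 * P` splits: `8 * P ≤ 2 * 2 ^ k * P` because `4 ≤ 2 ^
k`, and `8 * P ≤ 16 * n`. -/
theorem phaseStart_le_roundBound {k n : ℕ} (hk : 1 < k) (hn : 3 ≤ n) :
    phaseStart k (Nat.clog 2 n + 1) ≤ roundBound k n := by
  have h1 := two_pow_clog_le hn
  have h2 : 4 ≤ 2 ^ k := by
    calc 4 = 2 ^ 2 := rfl
      _ ≤ 2 ^ k := Nat.pow_le_pow_right (by norm_num) hk
  have h3 : 4 * 2 ^ Nat.clog 2 n ≤ 2 ^ k * 2 ^ Nat.clog 2 n := Nat.mul_le_mul_right _ h2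
  unfold phaseStart roundBound
  calc (3 * 2 ^ k + 8) * (2 ^ (Nat.clog 2 n + 1) - 1)
      ≤ (3 * 2 ^ k + 8) * 2 ^ (Nat.clog 2 n + 1) := Nat.mul_le_mul_left _ (Nat.sub_le _ _)
    _ = 6 * (2 ^ k * 2 ^ Nat.clog 2 n) + 16 * 2 ^ Nat.clog 2 n := by ring
    _ ≤ 8 * (2 ^ k * 2 ^ Nat.clog 2 n) + 23 * n := by omega
    _ = 2 ^ (k + Nat.clog 2 n + 3) + 23 * n := by ring

theorem roundBound_le {k n : ℕ} (hn : 3 ≤ n) : roundBound k n ≤ 39 * (2 ^ k * n) := by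
  have h1 := two_pow_clog_le hn
  have h2 : n ≤ 2 ^ k * n := Nat.le_mul_of_pos_left n (by positivity)
  have h3 := Nat.mul_le_mul_left (2 ^ k) h1
  unfold roundBound
  calc 2 ^ (k + Nat.clog 2 n + 3) + 23 * n
      = 8 * (2 ^ k * 2 ^ Nat.clog 2 n) + 23 * n := by ring
    _ ≤ 8 * (2 ^ k * (2 * n)) + 23 * (2 ^ k * n) := by omega
    _ = 39 * (2 ^ k * n) := by ring

/-- The algorithm explores the ring and terminates. -/
theorem explorer_solves (hk : 1 < k) (hn : 3 ≤ n) (hid : Function.Injective ident)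
    (ho : ∀ i, orient i = o) :
    ExplorationWithExplicitTermination (explorer.run ident orient start missing)
      (roundBound k n) := by
  set J := Nat.clog 2 n
  have hb := beginsPhase (start := start) (missing := missing) hk hid ho (le_refl J)
  have hlen : 0 < phaseLength k J := by rw [phaseLength_eq]; positivity
  obtain ⟨hexp, hcon⟩ := (phaseRun_of_beginsPhase ho hb).explores_and_concludes
    (wanderTime_pos hk J) (ofBits_injective.comp hid) (fun i => Nat.ofBits_lt_two_pow _) (by omega)
    (Nat.le_pow_clog (by norm_num) n)
  have hexplored : ∀ t, phaseStart k J + phaseLength k J ≤ t →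
      ExploredBy (explorer.run ident orient start missing) t := by
    intro t ht z
    obtain ⟨s, hs, i, hi⟩ := hexp (chart o z)
    exact ⟨phaseStart k J + s, by omega, i, chart_injective o hi⟩
  have hterm : ∀ i, (explorer.run ident orient start missing
      (phaseStart k J + phaseLength k J)).terminated i = true := fun i =>
    (end_of_phase ho hb i).2.mpr (hcon i)
  have hbound := phaseStart_le_roundBound hk hn
  rw [phaseStart_succ] at hbound
  refine ⟨hexplored _ hbound, fun i => terminated_mono rfl hbound (hterm i), fun t i hi => ?_⟩
  refine hexplored t ?_
  -- Termination is permanent, and everybody is still active one round before the end of the phase.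
  by_contra! hlt
  have := terminated_mono rfl (show t ≤ phaseStart k J + (phaseLength k J - 1) by omega) hi
  rw [(active_of_beginsPhase ho hb (by omega) i).1] at this
  exact Bool.false_ne_true this

end Phases

end DynamicRing

theorem mainTheorem2 :
    (∃ A : DynamicRing.Algorithm,
      ∀ (k n : ℕ), 1 < k → 3 ≤ n →
      ∀ (ident : Fin 3 → Fin k → Bool), Function.Injective ident →
      ∀ (orient : Fin 3 → DynamicRing.Rotation), DynamicRing.Chirality orient →
      ∀ (start : Fin 3 → ZMod n) (missing : ℕ → Option (ZMod n)),
        DynamicRing.ExplorationWithExplicitTermination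
          (A.run ident orient start missing) (DynamicRing.roundBound k n)) ∧
    (∃ C : ℕ, ∀ (k n : ℕ), 1 < k → 3 ≤ n →
      DynamicRing.roundBound k n ≤ C * (2 ^ k * n)) :=
  ⟨⟨DynamicRing.explorer, fun _ _ hk hn _ hid orient ho _ _ =>
    DynamicRing.explorer_solves (o := orient 0) hk hn hid fun i => ho i 0⟩,
    39, fun _ _ _ hn => DynamicRing.roundBound_le hn⟩
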